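/- Let $n\ge 1$ and let $H$ be an $n$-dimensional Hamiltonian, that is, a (possibly unbounded) self-adjoint operator on an infinite-dimensional separable complex Hilbert space $\mathcal H$, considered as a quantum system with $n$ degrees of freedom. If the spectrum of $H$ is countable, then: 1. $H$ has pure point spectrum: if $E$ is the spectral resolution of $H$ and $\mathcal H_{\mathrm{cont}}$ is the subspace of all $\psi\in\mathcal H$ whose spectral measure $\mu_\psi(\cdot)=\|E(\cdot)\psi\|^2$ has no atoms, then $\sigma_{\mathrm{cont}}(H):=\sigma(H|_{\mathcal H_{\mathrm{cont}}})=\emptyset$. 2. $H$ is integrable with self-adjoint commuting first integrals: there are $n$ self-adjoint operators $T_1,\dots,T_n$ on $\mathcal H$ which commute with each other and with $H$ (all spectral projections commute) and are functionally independent (no $T_i$ is a Borel function of the operators $T_j$, $j\ne i$), and a unitary map $U:\mathcal H\to L^2(\mathbb R^n)$ such that $A=UHU^{-1}$ and $N_i=UT_iU^{-1}$ are smooth functions $A=a(X,P)$, $N_i=t_i(X,P)$ of the position and momentum operators $X_j\psi=x_j\psi$, $P_j\psi=-\mathrm i\,\partial_j\psi$. Here $a,t_1,\dots,t_n\in C^\infty(\mathbb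 R^{2n},\mathbb R)$ form a classically (Liouville) integrable system: $\{a,t_i\}=\{t_i,t_j\}=0$ for all $i,j$, and $dt_1,\dots,dt_n$ are linearly independent on a dense subset of $\mathbb R^{2n}$. The relation "the self-adjoint operator $A$ is the smooth function $a(X,P)$" is the smallest one such that: (i) if the symmetrized polynomial $q(X,P)$, with $q$ a real polynomial, is essentially self-adjoint on the Schwartz space, its closure is $q(X,P)$; (ii) if $T_j=t_j(X,P)$, $j=1,\dots,k$, have a joint spectral resolution and $f\in C^\infty(\mathbb R^k,\mathbb R)$, then $f(T_1,\dots,T_k)$, defined by the joint functional calculus, is $f(t_1,\dots,t_k)(X,P)$; (iii) if $A=a(X,P)$, $B=b(X,P)$ and $A+B$ has a self-adjoint closure, that closure is $(a+b)(X,P)$. -/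

import Mathlib

open MeasureTheory
open scoped ContDiff SchwartzMap

noncomputable section

namespace QuantumIntegrability

/-! ### Projection-valued measures and spectral integrals -/

section Abstract

variable {ℋ : Type*} [NormedAddCommGroup ℋ] [InnerProductSpace ℂ ℋ] [CompleteSpace ℋ]

/-- A projection-valued measure on `α` with values in the orthogonal projections of `ℋ`
(only the values on measurable sets matter). -/
structure PVM (α : Type*) [MeasurableSpace α] (ℋ : Type*) [NormedAddCommGroup ℋ]
    [InnerProductSpace ℂ ℋ] [CompleteSpace ℋ] where
  proj : Set α → ℋ →L[ℂ] ℋ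
  isStarProjection : ∀ s, MeasurableSet s → IsStarProjection (proj s)
  proj_empty : proj ∅ = 0
  proj_univ : proj Set.univ = 1
  proj_inter : ∀ s t, MeasurableSet s → MeasurableSet t → proj (s ∩ t) = proj s * proj t
  hasSum_iUnion : ∀ s : ℕ → Set α, (∀ i, MeasurableSet (s i)) →
    Pairwise (Function.onFun Disjoint s) → ∀ ψ : ℋ,
      HasSum (fun i => proj (s i) ψ) (proj (⋃ i, s i) ψ)

variable {α : Type*} [MeasurableSpace α]

theorem PVM.inner_proj (E : PVM α ℋ) {s : Set α} (hs : MeasurableSet s) (ψ : ℋ) :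
    RCLike.re (inner ℂ ψ (E.proj s ψ)) = ‖E.proj s ψ‖ ^ 2 := by
  have h := E.isStarProjection s hs
  have h1 : E.proj s (E.proj s ψ) = E.proj s ψ := by
    have := congrArg (fun T : ℋ →L[ℂ] ℋ => T ψ) h.isIdempotentElem.eq
    simpa using this
  have h2 := (ContinuousLinearMap.isSelfAdjoint_iff_isSymmetric.mp h.isSelfAdjoint) ψ
    (E.proj s ψ)
  simp only [ContinuousLinearMap.coe_coe] at h2
  rw [h1] at h2
  rw [← h2, inner_self_eq_norm_sq]

/-- The spectral measure `μ_ψ(s) = ‖E(s) ψ‖²` of a vector `ψ`. -/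
def PVM.measure (E : PVM α ℋ) (ψ : ℋ) : Measure α :=
  Measure.ofMeasurable (fun s _ => ENNReal.ofReal (‖E.proj s ψ‖ ^ 2))
    (by simp [E.proj_empty])
    (by
      intro s hs hd
      have h := E.hasSum_iUnion s hs hd ψ
      have h' : HasSum (fun i => ‖E.proj (s i) ψ‖ ^ 2) (‖E.proj (⋃ i, s i) ψ‖ ^ 2) := by
        have h3 := (RCLike.reCLM (K := ℂ)).hasSum ((innerSL ℂ ψ).hasSum h)
        simp only [innerSL_apply_apply, RCLike.reCLM_apply,
          E.inner_proj (hs _), E.inner_proj (MeasurableSet.iUnion hs)] at h3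
        exact h3
      rw [← h'.tsum_eq, ENNReal.ofReal_tsum_of_nonneg (fun _ => by positivity) h'.summable])

theorem PVM.measure_apply (E : PVM α ℋ) (ψ : ℋ) {s : Set α} (hs : MeasurableSet s) :
    E.measure ψ s = ENNReal.ofReal (‖E.proj s ψ‖ ^ 2) :=
  Measure.ofMeasurable_apply s hs

/-- `B = ∫ f dE` for a real-valued measurable `f`: the domain of `B` consists of the `ψ` with
`f ∈ L²(μ_ψ)`, and `⟨ψ, B ψ⟩ = ∫ f dμ_ψ` on it (which determines `B` by polarization). -/
def PVM.IsIntegral (E : PVM α ℋ) (f : α → ℝ) (B : ℋ →ₗ.[ℂ] ℋ) : Prop :=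
  (∀ ψ : ℋ, ψ ∈ B.domain ↔ Integrable (fun x => f x ^ 2) (E.measure ψ)) ∧
    ∀ ψ : B.domain, inner ℂ (ψ : ℋ) (B ψ) = ((∫ x, f x ∂(E.measure (ψ : ℋ)) : ℝ) : ℂ)

/-- `E` is the spectral resolution of `T`, i.e. `T = ∫ x dE(x)`. -/
def IsSpectralResolution (E : PVM ℝ ℋ) (T : ℋ →ₗ.[ℂ] ℋ) : Prop :=
  E.IsIntegral (fun x => x) T

/-- `E` is the joint spectral resolution of the family `T`, i.e. `T j = ∫ x_j dE(x)`. -/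
def IsJointSpectralResolution {ι : Type*} (E : PVM (ι → ℝ) ℋ) (T : ι → ℋ →ₗ.[ℂ] ℋ) : Prop :=
  ∀ j, E.IsIntegral (fun x => x j) (T j)

/-- Two (possibly unbounded) self-adjoint operators commute: all their spectral projections
commute. -/
def StronglyCommute (S T : ℋ →ₗ.[ℂ] ℋ) : Prop :=
  ∃ E F : PVM ℝ ℋ, IsSpectralResolution E S ∧ IsSpectralResolution F T ∧
    ∀ s t, MeasurableSet s → MeasurableSet t → Commute (E.proj s) (F.proj t)

/-- `B` is a (Borel) function of the commuting family `T`, in the sense of the joint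
functional calculus. -/
def IsFunctionOf {ι : Type*} (B : ℋ →ₗ.[ℂ] ℋ) (T : ι → ℋ →ₗ.[ℂ] ℋ) : Prop :=
  ∃ E : PVM (ι → ℝ) ℋ, IsJointSpectralResolution E T ∧
    ∃ f : (ι → ℝ) → ℝ, Measurable f ∧ E.IsIntegral f B

/-- Commuting operators are functionally independent: none is a function of the others. -/
def FunctionallyIndependent {ι : Type*} (T : ι → ℋ →ₗ.[ℂ] ℋ) : Prop :=
  ∀ i, ¬ IsFunctionOf (T i) (fun j : {j : ι // j ≠ i} => T j)

/-- `T` is a family of commuting, self-adjoint, functionally independent first integrals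
of `H`. -/
structure AreFirstIntegrals {ι : Type*} (H : ℋ →ₗ.[ℂ] ℋ) (T : ι → ℋ →ₗ.[ℂ] ℋ) : Prop where
  selfAdjoint : ∀ i, IsSelfAdjoint (T i)
  commute : ∀ i j, StronglyCommute (T i) (T j)
  commute_hamiltonian : ∀ i, StronglyCommute H (T i)
  independent : FunctionallyIndependent T

/-! ### Pure point spectrum -/

/-- The subspace `ℋ_cont` of the vectors whose spectral measure has no atoms. -/
def PVM.contSubspace (E : PVM ℝ ℋ) : Submodule ℂ ℋ where
  carrier := {ψ | ∀ x : ℝ, E.measure ψ {x} = 0}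
  zero_mem' := fun x => by simp [E.measure_apply]
  add_mem' := by
    intro a b ha hb x
    have ha := ha x
    have hb := hb x
    rw [E.measure_apply _ (measurableSet_singleton x), ENNReal.ofReal_eq_zero] at ha hb ⊢
    have ha' : E.proj {x} a = 0 := by
      rw [← norm_eq_zero]; exact pow_eq_zero_iff (two_ne_zero) |>.mp (le_antisymm ha (by positivity))
    have hb' : E.proj {x} b = 0 := by
      rw [← norm_eq_zero]; exact pow_eq_zero_iff (two_ne_zero) |>.mp (le_antisymm hb (by positivity))
    simp [ha', hb']
  smul_mem' := by
    intro c a ha x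
    have ha := ha x
    rw [E.measure_apply _ (measurableSet_singleton x), ENNReal.ofReal_eq_zero] at ha ⊢
    have ha' : E.proj {x} a = 0 := by
      rw [← norm_eq_zero]; exact pow_eq_zero_iff (two_ne_zero) |>.mp (le_antisymm ha (by positivity))
    simp [ha']

end Abstract

section Spectrum

variable {ℋ : Type*} [NormedAddCommGroup ℋ] [InnerProductSpace ℂ ℋ]

/-- The resolvent set of an operator: the `z` for which `T - z` is a bijection of the domain
of `T` onto `ℋ` with bounded inverse. -/
def resolventSet (T : ℋ →ₗ.[ℂ] ℋ) : Set ℂ :=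
  {z | ∃ R : ℋ →L[ℂ] ℋ,
    (∀ w : ℋ, ∃ h : R w ∈ T.domain, T ⟨R w, h⟩ - z • R w = w) ∧
      ∀ x : T.domain, R (T x - z • (x : ℋ)) = x}

/-- The spectrum of an operator. -/
def spectrum (T : ℋ →ₗ.[ℂ] ℋ) : Set ℂ :=
  (resolventSet T)ᶜ

/-- The restriction of an operator to a subspace `K`, as an operator in `K`. -/
def restrictTo (T : ℋ →ₗ.[ℂ] ℋ) (K : Submodule ℂ ℋ) : K →ₗ.[ℂ] K where
  domain :=
    { carrier := {x | ∃ h : (x : ℋ) ∈ T.domain, T ⟨x, h⟩ ∈ K}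
      zero_mem' := ⟨T.domain.zero_mem, by
        have h : T ⟨((0 : K) : ℋ), T.domain.zero_mem⟩ = 0 := T.map_zero
        rw [h]; exact K.zero_mem⟩
      add_mem' := by
        rintro a b ⟨ha, ha'⟩ ⟨hb, hb'⟩
        refine ⟨T.domain.add_mem ha hb, ?_⟩
        have h : T ⟨((a + b : K) : ℋ), T.domain.add_mem ha hb⟩ = T ⟨a, ha⟩ + T ⟨b, hb⟩ :=
          T.map_add ⟨a, ha⟩ ⟨b, hb⟩
        rw [h]; exact K.add_mem ha' hb'
      smul_mem' := by
        rintro c a ⟨ha, ha'⟩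
        refine ⟨T.domain.smul_mem c ha, ?_⟩
        have h : T ⟨((c • a : K) : ℋ), T.domain.smul_mem c ha⟩ = c • T ⟨a, ha⟩ :=
          T.map_smul c ⟨a, ha⟩
        rw [h]; exact K.smul_mem c ha' }
  toFun :=
    { toFun := fun x => ⟨T ⟨((x : K) : ℋ), x.2.1⟩, x.2.2⟩
      map_add' := fun a b => Subtype.ext
        (T.map_add ⟨((a : K) : ℋ), a.2.1⟩ ⟨((b : K) : ℋ), b.2.1⟩)
      map_smul' := fun c a => Subtype.ext (T.map_smul c ⟨((a : K) : ℋ), a.2.1⟩) }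

/-- A self-adjoint operator has pure point spectrum: its continuous spectrum, i.e. the spectrum
of its restriction to `ℋ_cont`, is empty. -/
def HasPurePointSpectrum [CompleteSpace ℋ] (H : ℋ →ₗ.[ℂ] ℋ) : Prop :=
  ∃ E : PVM ℝ ℋ, IsSpectralResolution E H ∧ spectrum (restrictTo H E.contSubspace) = ∅

end Spectrum

/-! ### Functions of the position and momentum operators -/

/-- The Hilbert space `L²(ℝⁿ)`. -/
abbrev L2 (n : ℕ) : Type :=
  Lp ℂ 2 (volume : Measure (EuclideanSpace ℝ (Fin n)))

/-- Classical phase space `ℝ²ⁿ`; `Sum.inl j` is the coordinate `x_j`, `Sum.inr j` is `p_j`. -/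
abbrev Phase (n : ℕ) : Type := Fin n ⊕ Fin n → ℝ

/-- The position operator `X_j` on Schwartz functions. -/
def position {n : ℕ} (j : Fin n) : Module.End ℂ 𝓢(EuclideanSpace ℝ (Fin n), ℂ) :=
  (SchwartzMap.smulLeftCLM ℂ (fun x : EuclideanSpace ℝ (Fin n) => ((x j : ℝ) : ℂ))).toLinearMap

/-- The momentum operator `P_j = -i ∂_j` on Schwartz functions. -/
def momentum {n : ℕ} (j : Fin n) : Module.End ℂ 𝓢(EuclideanSpace ℝ (Fin n), ℂ) :=
  (-Complex.I) • (LineDeriv.lineDerivOpCLM ℂ 𝓢(EuclideanSpace ℝ (Fin n), ℂ)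
    (EuclideanSpace.single j (1 : ℝ))).toLinearMap

theorem position_apply {n : ℕ} (j : Fin n) (φ : 𝓢(EuclideanSpace ℝ (Fin n), ℂ))
    (x : EuclideanSpace ℝ (Fin n)) : position j φ x = (x j : ℂ) * φ x := by
  have h : (fun x : EuclideanSpace ℝ (Fin n) => ((x j : ℝ) : ℂ)).HasTemperateGrowth := by
    have h1 : (fun x : EuclideanSpace ℝ (Fin n) => x j).HasTemperateGrowth :=
      (EuclideanSpace.proj (𝕜 := ℝ) j).hasTemperateGrowth
    fun_prop
  simp [position, SchwartzMap.smulLeftCLM_apply_apply h]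

theorem momentum_apply {n : ℕ} (j : Fin n) (φ : 𝓢(EuclideanSpace ℝ (Fin n), ℂ))
    (x : EuclideanSpace ℝ (Fin n)) :
    momentum j φ x = -Complex.I * fderiv ℝ φ x (EuclideanSpace.single j 1) := by
  simp [momentum, SchwartzMap.lineDerivOp_apply_eq_fderiv]

/-- The Weyl (totally symmetrized) quantization of a monomial: the average, over all orderings
of its factors, of the corresponding products of position and momentum operators. -/
def weylMonomial {n : ℕ} (s : (Fin n ⊕ Fin n) →₀ ℕ) :
    Module.End ℂ 𝓢(EuclideanSpace ℝ (Fin n), ℂ) :=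
  let l := (Finsupp.toMultiset s).toList
  ((l.length.factorial : ℂ))⁻¹ •
    (l.permutations.map fun l' => (l'.map (Sum.elim position momentum)).prod).sum

/-- The Weyl quantization of a real polynomial on phase space, acting on Schwartz functions. -/
def weyl {n : ℕ} (q : MvPolynomial (Fin n ⊕ Fin n) ℝ) :
    Module.End ℂ 𝓢(EuclideanSpace ℝ (Fin n), ℂ) :=
  ∑ s ∈ q.support, ((q.coeff s : ℝ) : ℂ) • weylMonomial s

/-- `A` is the closure of the operator `D` on Schwartz functions. -/
def IsClosureOf {n : ℕ} (A : L2 n →ₗ.[ℂ] L2 n)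
    (D : Module.End ℂ 𝓢(EuclideanSpace ℝ (Fin n), ℂ)) : Prop :=
  (A.graph : Set (L2 n × L2 n)) =
    closure (Set.range fun φ : 𝓢(EuclideanSpace ℝ (Fin n), ℂ) => (φ.toLp 2, (D φ).toLp 2))

/-- `IsQuantization a A`: the self-adjoint operator `A` on `L²(ℝⁿ)` is the smooth function
`a(X, P)` of the position and momentum operators. The class is generated from the polynomials in
`X` and `P` by smooth functions of commuting operators and by sums. -/
inductive IsQuantization {n : ℕ} : (Phase n → ℝ) → (L2 n →ₗ.[ℂ] L2 n) → Prop
  | polynomial (q : MvPolynomial (Fin n ⊕ Fin n) ℝ) (A : L2 n →ₗ.[ℂ] L2 n)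
      (hA : IsSelfAdjoint A) (hq : IsClosureOf A (weyl q)) :
      IsQuantization (fun z => MvPolynomial.eval z q) A
  | calculus {k : ℕ} (t : Fin k → Phase n → ℝ) (T : Fin k → L2 n →ₗ.[ℂ] L2 n)
      (hT : ∀ j, IsQuantization (t j) (T j))
      (E : PVM (Fin k → ℝ) (L2 n)) (hE : IsJointSpectralResolution E T)
      (f : (Fin k → ℝ) → ℝ) (hf : ContDiff ℝ ∞ f)
      (A : L2 n →ₗ.[ℂ] L2 n) (hA : E.IsIntegral f A) :
      IsQuantization (fun z => f (fun j => t j z)) A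
  | sum (a b : Phase n → ℝ) (A B C : L2 n →ₗ.[ℂ] L2 n)
      (ha : IsQuantization a A) (hb : IsQuantization b B) (hC : IsSelfAdjoint C)
      (hsum : C.graph = (A + B).graph.topologicalClosure) :
      IsQuantization (fun z => a z + b z) C

/-- The Poisson bracket on phase space. -/
def poisson {n : ℕ} (a b : Phase n → ℝ) (z : Phase n) : ℝ :=
  ∑ j : Fin n,
    (fderiv ℝ a z (Pi.single (Sum.inl j) 1) * fderiv ℝ b z (Pi.single (Sum.inr j) 1) -
      fderiv ℝ a z (Pi.single (Sum.inr j) 1) * fderiv ℝ b z (Pi.single (Sum.inl j) 1))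

/-- Liouville integrability of the classical Hamiltonian `a`: the `t i` are smooth first integrals
in involution, with differentials linearly independent on a dense set. -/
structure IsLiouvilleIntegrable {n : ℕ} (a : Phase n → ℝ) (t : Fin n → Phase n → ℝ) : Prop where
  smooth_hamiltonian : ContDiff ℝ ∞ a
  smooth : ∀ i, ContDiff ℝ ∞ (t i)
  first_integral : ∀ i z, poisson a (t i) z = 0
  involution : ∀ i j z, poisson (t i) (t j) z = 0
  independent : Dense {z | LinearIndependent ℝ (fun i => fderiv ℝ (t i) z)}

/-! ### Integrability -/

section Integrability

variable {ℋ : Type*} [NormedAddCommGroup ℋ] [InnerProductSpace ℂ ℋ] [CompleteSpace ℋ]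

/-- `U H U⁻¹ = A`, domains included. -/
def Intertwines {n : ℕ} (U : ℋ ≃ₗᵢ[ℂ] L2 n) (H : ℋ →ₗ.[ℂ] ℋ) (A : L2 n →ₗ.[ℂ] L2 n) : Prop :=
  ∀ ψ φ : ℋ, (ψ, φ) ∈ H.graph ↔ (U ψ, U φ) ∈ A.graph

/-- The Hamiltonian `H` is integrable, as an `n`-dimensional Hamiltonian, with the self-adjoint
commuting first integrals `T i`: a unitary map onto `L²(ℝⁿ)` turns `H` and the `T i` into
operators `A` and `N i` that are smooth functions `a(X, P)`, `t i (X, P)` of position and momentum,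
where the `t i` make `a` a classically integrable Hamiltonian. -/
def IsIntegrableWith (n : ℕ) (H : ℋ →ₗ.[ℂ] ℋ) (T : Fin n → ℋ →ₗ.[ℂ] ℋ) : Prop :=
  AreFirstIntegrals H T ∧
    ∃ (U : ℋ ≃ₗᵢ[ℂ] L2 n) (A : L2 n →ₗ.[ℂ] L2 n) (N : Fin n → L2 n →ₗ.[ℂ] L2 n)
      (a : Phase n → ℝ) (t : Fin n → Phase n → ℝ),
      IsSelfAdjoint A ∧ Intertwines U H A ∧ (∀ i, Intertwines U (T i) (N i)) ∧
      AreFirstIntegrals A N ∧ IsQuantization a A ∧ (∀ i, IsQuantization (t i) (N i)) ∧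
      IsLiouvilleIntegrable a t

end Integrability

end QuantumIntegrability

end

/-!
By Baire's theorem, a nonempty countable closed set has an isolated point, and an isolated point of
the spectrum of a bounded self-adjoint operator is an eigenvalue. The orthogonal complement of all
eigenvectors reduces the operator to one with countable spectrum and no eigenvalue, so it vanishes
and the operator is diagonal in a Hilbert basis. This applies to `(H - x)⁻¹` for a real `x` outside
the spectrum of `H`, hence `H` itself is diagonal. As the space is infinite-dimensional and
separable, the basis can be indexed by `ℕⁿ`, and the unitary map sending it to the Hermite basis of
`L²(ℝⁿ)` turns `H` into `f (N₁, …, Nₙ)`, where `Nⱼ` is the number operator `(Xⱼ² + Pⱼ² - 1) / 2` of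
the `j`-th harmonic oscillator and `f` is a smooth function interpolating the eigenvalues at the
points of `ℕⁿ`. The classical symbols `(xⱼ² + pⱼ² - 1) / 2` Poisson commute, and their differentials
are linearly independent wherever no coordinate vanishes.
-/

noncomputable section

namespace QuantumIntegrability

/-! ### Hilbert bases -/

section HilbertBasis

variable {𝕜 E ι : Type*} [RCLike 𝕜] [NormedAddCommGroup E] [InnerProductSpace 𝕜 E]

theorem one_le_dist_of_orthonormal {v : ι → E} (hv : Orthonormal 𝕜 v) {i j : ι} (hij : i ≠ j) :
    1 ≤ dist (v i) (v j) := by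
  have h := norm_sub_sq (𝕜 := 𝕜) (v i) (v j)
  rw [hv.inner_eq_zero hij, hv.norm_eq_one, hv.norm_eq_one, map_zero] at h
  rw [dist_eq_norm]
  nlinarith [norm_nonneg (v i - v j)]

theorem countable_of_orthonormal [TopologicalSpace.SeparableSpace E] {v : ι → E}
    (hv : Orthonormal 𝕜 v) : Countable ι := by
  have hdisj : Pairwise (Function.onFun Disjoint fun i => Metric.ball (v i) (1 / 2)) :=
    fun i j hij => Metric.ball_disjoint_ball (by
      linarith [one_le_dist_of_orthonormal hv hij])
  exact hdisj.countable_of_isOpen_disjoint (fun _ => Metric.isOpen_ball)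
    fun i => ⟨v i, Metric.mem_ball_self (by norm_num)⟩

theorem infinite_of_hilbertBasis (b : HilbertBasis ι 𝕜 E) (hE : ¬ FiniteDimensional 𝕜 E) :
    Infinite ι := by
  refine not_finite_iff_infinite.mp fun _ => hE ?_
  have := Fintype.ofFinite ι
  exact Module.Finite.of_basis b.toOrthonormalBasis.toBasis

variable (b : HilbertBasis ι 𝕜 E)

theorem exists_hilbertBasis_reindex [CompleteSpace E] {κ : Type*} (e : κ ≃ ι) :
    ∃ c : HilbertBasis κ 𝕜 E, ∀ k, c k = b (e k) := by
  have hdense : ⊤ ≤ (Submodule.span 𝕜 (Set.range (b ∘ e))).topologicalClosure := by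
    rw [e.surjective.range_comp, b.dense_span]
  exact ⟨HilbertBasis.mk (b.orthonormal.comp e e.injective) hdense,
    fun k => by rw [HilbertBasis.coe_mk, Function.comp_apply]⟩

theorem hasSum_norm_sq_repr (ψ : E) : HasSum (fun i => ‖b.repr ψ i‖ ^ 2) (‖ψ‖ ^ 2) := by
  simpa using lp.hasSum_norm (by simp) (b.repr ψ)

theorem eq_of_forall_repr_eq {ψ φ : E} (h : ∀ i, b.repr ψ i = b.repr φ i) : ψ = φ :=
  b.repr.injective (lp.ext (funext h))

theorem exists_repr_eq_iff {c : ι → 𝕜} :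
    (∃ φ, ∀ i, b.repr φ i = c i) ↔ Summable fun i => ‖c i‖ ^ 2 := by
  have hmem : Memℓp c 2 ↔ Summable fun i => ‖c i‖ ^ 2 := by
    rw [memℓp_gen_iff (by simp)]
    simp
  rw [← hmem]
  constructor
  · rintro ⟨φ, hφ⟩
    rw [← funext hφ]
    exact lp.memℓp (b.repr φ)
  · intro hc
    exact ⟨b.repr.symm ⟨c, hc⟩, fun i => by rw [LinearIsometryEquiv.apply_symm_apply]⟩

end HilbertBasis

/-! ### Operators diagonal in a Hilbert basis -/

section Diagonal

variable {ℋ : Type*} [NormedAddCommGroup ℋ] [InnerProductSpace ℂ ℋ]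
variable {ι : Type*} (b : HilbertBasis ι ℂ ℋ)

/-- The graph of multiplication of the `i`-th coordinate by `l i`. -/
def diagGraph (l : ι → ℝ) : Submodule ℂ (ℋ × ℋ) where
  carrier := {p | ∀ i, b.repr p.2 i = l i * b.repr p.1 i}
  zero_mem' i := by simp
  add_mem' hp hq i := by simp [hp i, hq i, mul_add]
  smul_mem' c p hp i := by simp [hp i, mul_left_comm]

/-- The operator that multiplies the `i`-th coordinate by `l i`, on its maximal domain. -/
def diagOp (l : ι → ℝ) : ℋ →ₗ.[ℂ] ℋ :=
  (diagGraph b l).toLinearPMap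

theorem mem_graph_diagOp (l : ι → ℝ) (p : ℋ × ℋ) :
    p ∈ (diagOp b l).graph ↔ ∀ i, b.repr p.2 i = l i * b.repr p.1 i := by
  rw [diagOp, Submodule.toLinearPMap_graph_eq]
  · rfl
  · rintro ⟨ψ, φ⟩ hp rfl
    exact eq_of_forall_repr_eq b fun i => by simpa using hp i

theorem repr_diagOp (l : ι → ℝ) (ψ : (diagOp b l).domain) (i : ι) :
    b.repr (diagOp b l ψ) i = l i * b.repr (ψ : ℋ) i :=
  (mem_graph_diagOp b l _).mp ((diagOp b l).mem_graph ψ) i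

theorem mem_diagOp_domain (l : ι → ℝ) (ψ : ℋ) :
    ψ ∈ (diagOp b l).domain ↔ Summable fun i => l i ^ 2 * ‖b.repr ψ i‖ ^ 2 := by
  have h := exists_repr_eq_iff b (c := fun i => (l i : ℂ) * b.repr ψ i)
  simp only [norm_mul, Complex.norm_real, Real.norm_eq_abs, mul_pow, sq_abs] at h
  rw [← h, LinearPMap.mem_domain_iff]
  exact exists_congr fun φ => mem_graph_diagOp b l (ψ, φ)

theorem basis_mem_graph_diagOp (l : ι → ℝ) (i : ι) :
    (b i, (l i : ℂ) • b i) ∈ (diagOp b l).graph := by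
  classical
  rw [mem_graph_diagOp]
  intro j
  simp only [map_smul, lp.coeFn_smul, Pi.smul_apply, smul_eq_mul, b.repr_self,
    lp.coeFn_single]
  rcases eq_or_ne j i with rfl | hij
  · rfl
  · simp only [Pi.single_eq_of_ne hij, mul_zero]

theorem dense_diagOp_domain (l : ι → ℝ) : Dense ((diagOp b l).domain : Set ℋ) := by
  have hspan : Submodule.span ℂ (Set.range b) ≤ (diagOp b l).domain := by
    rw [Submodule.span_le]
    rintro _ ⟨i, rfl⟩
    exact LinearPMap.mem_domain_of_mem_graph (basis_mem_graph_diagOp b l i)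
  exact ((Submodule.dense_iff_topologicalClosure_eq_top).mpr b.dense_span).mono hspan

theorem intertwines_diagOp {n : ℕ} (c : HilbertBasis ι ℂ (L2 n)) (l : ι → ℝ) :
    Intertwines (b.repr.trans c.repr.symm) (diagOp b l) (diagOp c l) := by
  intro ψ φ
  rw [mem_graph_diagOp, mem_graph_diagOp]
  simp

theorem isFormalAdjoint_diagOp (l : ι → ℝ) : (diagOp b l).IsFormalAdjoint (diagOp b l) := by
  intro ψ φ
  rw [← b.repr.inner_map_map, ← b.repr.inner_map_map, lp.inner_eq_tsum, lp.inner_eq_tsum]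
  refine tsum_congr fun i => ?_
  simp only [repr_diagOp, RCLike.inner_apply, map_mul, Complex.conj_ofReal]
  ring

theorem le_diagOp_of_isFormalAdjoint {S T : ℋ →ₗ.[ℂ] ℋ} (hST : S.IsFormalAdjoint T) {l : ι → ℝ}
    (hT : ∀ i, (b i, (l i : ℂ) • b i) ∈ T.graph) : S ≤ diagOp b l := by
  refine LinearPMap.le_of_le_graph fun p hp => ?_
  obtain ⟨ψ, hψ, hSψ⟩ := (LinearPMap.mem_graph_iff _).mp hp
  rw [mem_graph_diagOp]
  intro i
  obtain ⟨e, he, hTe⟩ := (LinearPMap.mem_graph_iff _).mp (hT i)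
  have hadj := hST ψ e
  rw [he, hTe, hψ, hSψ] at hadj
  rw [b.repr_apply_apply, b.repr_apply_apply, ← inner_conj_symm, hadj, inner_smul_right,
    map_mul, inner_conj_symm, Complex.conj_ofReal]

section SelfAdjoint

variable [CompleteSpace ℋ]

theorem isSelfAdjoint_diagOp (l : ι → ℝ) : IsSelfAdjoint (diagOp b l) := by
  have hdense := dense_diagOp_domain b l
  exact LinearPMap.isSelfAdjoint_def.mpr <| le_antisymm
    (le_diagOp_of_isFormalAdjoint b (LinearPMap.adjoint_isFormalAdjoint hdense)
      (basis_mem_graph_diagOp b l))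
    ((isFormalAdjoint_diagOp b l).le_adjoint hdense)

theorem isFormalAdjoint_of_isSelfAdjoint {H : ℋ →ₗ.[ℂ] ℋ} (hH : IsSelfAdjoint H) :
    H.IsFormalAdjoint H := by
  have h := LinearPMap.adjoint_isFormalAdjoint hH.dense_domain
  rwa [LinearPMap.isSelfAdjoint_def.mp hH] at h

-- Self-adjoint operators are maximal symmetric, so one inclusion suffices.
theorem eq_diagOp_of_eigenbasis {H : ℋ →ₗ.[ℂ] ℋ} (hH : IsSelfAdjoint H) {l : ι → ℝ}
    (h : ∀ i, (b i, (l i : ℂ) • b i) ∈ H.graph) : H = diagOp b l := by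
  have hle : H ≤ diagOp b l :=
    le_diagOp_of_isFormalAdjoint b (isFormalAdjoint_of_isSelfAdjoint hH) h
  have hge : diagOp b l ≤ H.adjoint := by
    refine LinearPMap.IsFormalAdjoint.le_adjoint hH.dense_domain fun ψ φ => ?_
    have hψ : H ψ = diagOp b l ⟨ψ, hle.1 ψ.2⟩ := hle.2 rfl
    rw [hψ]
    exact isFormalAdjoint_diagOp b l _ φ
  rw [LinearPMap.isSelfAdjoint_def.mp hH] at hge
  exact le_antisymm hle hge

end SelfAdjoint

section CoordProj

variable [CompleteSpace ℋ]

/-- The orthogonal projection onto the vectors whose coordinates vanish outside `t`. -/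
def coordProj (t : Set ι) : ℋ →L[ℂ] ℋ :=
  (Submodule.span ℂ (b '' tᶜ))ᗮ.starProjection

theorem repr_coordProj (t : Set ι) (ψ : ℋ) (i : ι) :
    b.repr (coordProj b t ψ) i = t.indicator (b.repr ψ) i := by
  rw [b.repr_apply_apply]
  by_cases hi : i ∈ t
  · have hbi : b i ∈ (Submodule.span ℂ (b '' tᶜ))ᗮ := by
      refine (Submodule.mem_orthogonal _ _).mpr fun u hu => ?_
      refine Submodule.span_induction ?_ (inner_zero_left _) ?_ ?_ hu
      · rintro _ ⟨j, hj, rfl⟩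
        exact b.orthonormal.inner_eq_zero fun hji => hj (hji ▸ hi)
      · intro x y _ _ hx hy
        rw [inner_add_left, hx, hy, add_zero]
      · intro c x _ hx
        rw [inner_smul_left, hx, mul_zero]
    rw [Set.indicator_of_mem hi, b.repr_apply_apply, coordProj,
      ← Submodule.inner_starProjection_left_eq_right, Submodule.starProjection_eq_self_iff.mpr hbi]
  · rw [Set.indicator_of_notMem hi]
    exact Submodule.inner_right_of_mem_orthogonal
      (Submodule.subset_span (Set.mem_image_of_mem b hi))
      (Submodule.starProjection_apply_mem _ ψ)

theorem coordProj_empty : coordProj b ∅ = 0 := by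
  ext ψ
  exact eq_of_forall_repr_eq b fun i => by simp [repr_coordProj]

theorem coordProj_univ : coordProj b Set.univ = 1 := by
  ext ψ
  exact eq_of_forall_repr_eq b fun i => by simp [repr_coordProj]

theorem coordProj_inter (s t : Set ι) : coordProj b (s ∩ t) = coordProj b s * coordProj b t := by
  classical
  ext ψ
  refine eq_of_forall_repr_eq b fun i => ?_
  rw [mul_apply_eq_comp]
  simp only [repr_coordProj, Set.indicator_apply, Set.mem_inter_iff, ite_and]

theorem commute_coordProj (s t : Set ι) : Commute (coordProj b s) (coordProj b t) := by
  rw [Commute, SemiconjBy, ← coordProj_inter, ← coordProj_inter, Set.inter_comm]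

theorem hasSum_coordProj (t : Set ι) (ψ : ℋ) :
    HasSum (fun i : t => b.repr ψ i • b i) (coordProj b t ψ) := by
  classical
  refine (hasSum_subtype_iff_indicator (f := fun i => b.repr ψ i • b i)).mpr ?_
  convert! b.hasSum_repr (coordProj b t ψ) using 2 with i
  rw [repr_coordProj, Set.indicator_apply, Set.indicator_apply, ite_smul, zero_smul]

end CoordProj

/-! ### Projection-valued measures supported by a Hilbert basis -/

section DiagPVM

variable [CompleteSpace ℋ] {α : Type*} [MeasurableSpace α] (g : ι → α)

/-- The projection-valued measure whose value on `s` projects onto the coordinates `i` with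
`g i ∈ s`. -/
def diagPVM : PVM α ℋ where
  proj s := coordProj b (g ⁻¹' s)
  isStarProjection s _ := isStarProjection_starProjection
  proj_empty := by rw [Set.preimage_empty, coordProj_empty]
  proj_univ := by rw [Set.preimage_univ, coordProj_univ]
  proj_inter s t _ _ := by rw [Set.preimage_inter, coordProj_inter]
  hasSum_iUnion s _ hd ψ := by
    have hd' : Pairwise (Function.onFun Disjoint fun n => g ⁻¹' s n) :=
      fun m n hmn => (hd hmn).preimage g
    have h := hasSum_coordProj b (⋃ n, g ⁻¹' s n) ψ
    rw [← (Set.unionEqSigmaOfDisjoint hd').symm.hasSum_iff] at h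
    rw [Set.preimage_iUnion]
    exact h.sigma fun n => hasSum_coordProj b (g ⁻¹' s n) ψ

theorem measure_diagPVM (ψ : ℋ) :
    (diagPVM b g).measure ψ =
      Measure.sum fun i => ENNReal.ofReal (‖b.repr ψ i‖ ^ 2) • Measure.dirac (g i) := by
  classical
  ext s hs
  have hparseval := hasSum_norm_sq_repr b ((diagPVM b g).proj s ψ)
  rw [PVM.measure_apply _ _ hs, Measure.sum_apply _ hs, ← hparseval.tsum_eq,
    ENNReal.ofReal_tsum_of_nonneg (fun _ => by positivity) hparseval.summable]
  refine tsum_congr fun i => ?_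
  rw [diagPVM, repr_coordProj, Measure.smul_apply, Measure.dirac_apply' _ hs]
  by_cases hi : g i ∈ s <;> simp [hi]

theorem isIntegral_diagPVM [Countable ι] [MeasurableSingletonClass α] (f : α → ℝ) :
    (diagPVM b g).IsIntegral f (diagOp b fun i => f (g i)) := by
  constructor
  · intro ψ
    rw [measure_diagPVM, integrable_sum_dirac_iff (fun i => ENNReal.ofReal_ne_top),
      mem_diagOp_domain]
    simp [mul_comm]
  · intro ψ
    rw [measure_diagPVM, integral_sum_dirac (fun i => ENNReal.ofReal_ne_top),
      ← b.repr.inner_map_map, lp.inner_eq_tsum, Complex.ofReal_tsum]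
    refine tsum_congr fun i => ?_
    rw [repr_diagOp, RCLike.inner_apply, mul_assoc, RCLike.mul_conj,
      ENNReal.toReal_ofReal (by positivity), smul_eq_mul, mul_comm]
    push_cast
    rfl

theorem stronglyCommute_diagOp [Countable ι] (l m : ι → ℝ) :
    StronglyCommute (diagOp b l) (diagOp b m) :=
  ⟨diagPVM b l, diagPVM b m, isIntegral_diagPVM b l id, isIntegral_diagPVM b m id,
    fun _ _ _ _ => commute_coordProj b _ _⟩

theorem contSubspace_diagPVM (l : ι → ℝ) : (diagPVM b l).contSubspace = ⊥ := by
  refine (Submodule.eq_bot_iff _).mpr fun ψ hψ => eq_of_forall_repr_eq b fun i => ?_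
  have hatom : (diagPVM b l).measure ψ {l i} = 0 := hψ (l i)
  rw [measure_diagPVM, Measure.sum_apply _ (measurableSet_singleton _),
    ENNReal.tsum_eq_zero] at hatom
  simpa using hatom i

theorem spectrum_eq_empty_of_subsingleton {K : Type*} [NormedAddCommGroup K]
    [InnerProductSpace ℂ K] [Subsingleton K] (T : K →ₗ.[ℂ] K) : spectrum T = ∅ :=
  Set.compl_empty_iff.mpr <| Set.eq_univ_of_forall fun _ =>
    ⟨0, fun _ => ⟨T.domain.zero_mem, Subsingleton.elim _ _⟩, fun _ => Subsingleton.elim _ _⟩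

theorem hasPurePointSpectrum_diagOp [Countable ι] (l : ι → ℝ) :
    HasPurePointSpectrum (diagOp b l) := by
  refine ⟨diagPVM b l, isIntegral_diagPVM b l id, ?_⟩
  have : Subsingleton (diagPVM b l).contSubspace :=
    Submodule.subsingleton_iff_eq_bot.mpr (contSubspace_diagPVM b l)
  exact spectrum_eq_empty_of_subsingleton _

end DiagPVM

end Diagonal

/-! ### Bounded self-adjoint operators with countable spectrum -/

section Isolated

open Filter Topology

theorem exists_isolated_of_countable {X : Type*} [MetricSpace X] [CompleteSpace X] {C : Set X}
    (hC : IsClosed C) (hne : C.Nonempty) (hcount : C.Countable) :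
    ∃ x ∈ C, ∀ᶠ y in 𝓝[C] x, y = x := by
  have := hC.completeSpace_coe
  have := hne.to_subtype
  have := hcount.to_subtype
  -- Baire: the singletons are countably many closed sets covering `C`.
  obtain ⟨x, hx⟩ := nonempty_interior_of_iUnion_of_closed (fun x : C => isClosed_singleton (x := x))
    (Set.iUnion_of_singleton C)
  have hopen : IsOpen {x} := interior_eq_iff_isOpen.mp <|
    (Set.subset_singleton_iff_eq.mp interior_subset).resolve_left hx.ne_empty
  refine ⟨x, x.2, ?_⟩
  rw [← map_nhds_subtype_val, Filter.eventually_map]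
  filter_upwards [hopen.mem_nhds rfl] with y hy using congrArg _ hy

theorem continuousOn_indicator_singleton {X M : Type*} [TopologicalSpace X] [T1Space X]
    [TopologicalSpace M] [Zero M] {s : Set X} {x : X} (hx : ∀ᶠ y in 𝓝[s] x, y = x) (c : X → M) :
    ContinuousOn (Set.indicator {x} c) s := by
  intro y _
  rcases eq_or_ne y x with rfl | hyx
  · exact continuousWithinAt_const.congr_of_eventuallyEq (hx.mono fun z hz => by rw [hz]) rfl
  · have hzero : ∀ᶠ z in 𝓝[s] y, Set.indicator {x} c z = 0 :=
      ((eventually_ne_nhds hyx).filter_mono nhdsWithin_le_nhds).mono fun z hz =>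
        Set.indicator_of_notMem (s := {x}) hz c
    exact continuousWithinAt_const.congr_of_eventuallyEq hzero
      (Set.indicator_of_notMem (s := {x}) hyx c)

variable {A : Type*} [CStarAlgebra A] {a : A} {x : ℝ}

theorem cfc_indicator_singleton_ne_zero (ha : IsSelfAdjoint a) (hx : x ∈ _root_.spectrum ℝ a)
    (hiso : ∀ᶠ y in 𝓝[_root_.spectrum ℝ a] x, y = x) :
    cfc (Set.indicator {x} 1 : ℝ → ℝ) a ≠ 0 := by
  have : Nontrivial A := by
    by_contra hA
    have := not_nontrivial_iff_subsingleton.mp hA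
    simp [spectrum.of_subsingleton] at hx
  intro h
  have hone : (1 : ℝ) ∈ _root_.spectrum ℝ (cfc (Set.indicator {x} 1 : ℝ → ℝ) a) := by
    rw [cfc_map_spectrum (R := ℝ) _ a ha (continuousOn_indicator_singleton hiso 1)]
    exact ⟨x, hx, Set.indicator_of_mem rfl _⟩
  rw [h, spectrum.zero_eq] at hone
  exact one_ne_zero hone

theorem mul_cfc_indicator_singleton (ha : IsSelfAdjoint a)
    (hiso : ∀ᶠ y in 𝓝[_root_.spectrum ℝ a] x, y = x) :
    a * cfc (Set.indicator {x} 1 : ℝ → ℝ) a = x • cfc (Set.indicator {x} 1 : ℝ → ℝ) a := by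
  have hcont := continuousOn_indicator_singleton hiso (1 : ℝ → ℝ)
  have hfun : (fun y => y * Set.indicator {x} (1 : ℝ → ℝ) y) =
      fun y => x • Set.indicator {x} (1 : ℝ → ℝ) y := by
    ext y
    by_cases hyx : y = x <;> simp [hyx]
  calc a * cfc (Set.indicator {x} 1 : ℝ → ℝ) a
      = cfc (fun y => y * Set.indicator {x} (1 : ℝ → ℝ) y) a := by
        rw [cfc_mul (fun y => y) _ a continuousOn_id hcont, cfc_id' ℝ a]
    _ = x • cfc (Set.indicator {x} 1 : ℝ → ℝ) a := by rw [hfun, cfc_smul x _ a hcont]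

end Isolated

section Restrict

variable {𝕜 E : Type*} [RCLike 𝕜] [NormedAddCommGroup E] [InnerProductSpace 𝕜 E]
variable {N : Submodule 𝕜 E} [N.HasOrthogonalProjection] {A : E →L[𝕜] E}

theorem commute_starProjection_of_isSelfAdjoint [CompleteSpace E] (hA : IsSelfAdjoint A)
    (hN : ∀ v ∈ N, A v ∈ N) : Commute N.starProjection A := by
  have hidem : IsIdempotentElem N.starProjection := isStarProjection_starProjection.isIdempotentElem
  rw [ContinuousLinearMap.IsIdempotentElem.commute_iff hidem, Submodule.range_starProjection,
    Submodule.ker_starProjection]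
  refine ⟨hN, ContinuousLinearMap.orthogonal_mem_invtSubmodule ?_⟩
  rw [← ContinuousLinearMap.star_eq_adjoint, hA.star_eq]
  exact hN

theorem isUnit_restrict (hA : IsUnit A) (hcomm : Commute N.starProjection A)
    (hN : ∀ v ∈ N, A v ∈ N) : IsUnit (A.restrict hN) := by
  obtain ⟨u, rfl⟩ := hA
  have hinv : ∀ v ∈ N, (↑u⁻¹ : E →L[𝕜] E) v ∈ N := by
    intro v hv
    have h := DFunLike.congr_fun hcomm.units_inv_right.eq v
    rw [mul_apply_eq_comp, mul_apply_eq_comp,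
      Submodule.starProjection_eq_self_iff.mpr hv] at h
    exact Submodule.starProjection_eq_self_iff.mp h
  refine ⟨⟨_, (↑u⁻¹ : E →L[𝕜] E).restrict hinv, ?_, ?_⟩, rfl⟩
  · ext v
    exact DFunLike.congr_fun u.mul_inv (v : E)
  · ext v
    exact DFunLike.congr_fun u.inv_mul (v : E)

theorem spectrum_restrict_subset (hcomm : Commute N.starProjection A)
    (hN : ∀ v ∈ N, A v ∈ N) : _root_.spectrum 𝕜 (A.restrict hN) ⊆ _root_.spectrum 𝕜 A := by
  intro z
  contrapose!
  rw [spectrum.notMem_iff, spectrum.notMem_iff]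
  intro hz
  exact isUnit_restrict hz ((Algebra.commute_algebraMap_right z _).sub_right hcomm)
    fun v hv => N.sub_mem (N.smul_mem z hv) (hN v hv)

theorem exists_hilbertBasis_of_orthogonalFamily [CompleteSpace E] {ι : Type*}
    {V : ι → Submodule 𝕜 E} [∀ i, CompleteSpace (V i)]
    (hV : OrthogonalFamily 𝕜 (fun i => V i) fun i => (V i).subtypeₗᵢ) (htop : (⨆ i, V i)ᗮ = ⊥) :
    ∃ (w : ∀ i, Set (V i)) (b : HilbertBasis (Σ i, w i) 𝕜 E), ∀ k, b k ∈ V k.1 := by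
  choose w b hb using fun i => exists_hilbertBasis 𝕜 (V i)
  have hortho : Orthonormal 𝕜 fun k : Σ i, w i => ((k.2 : V k.1) : E) :=
    hV.orthonormal_sigma_orthonormal fun i => hb i ▸ (b i).orthonormal
  have hspan : (Submodule.span 𝕜 (Set.range fun k : Σ i, w i => ((k.2 : V k.1) : E)))ᗮ = ⊥ := by
    rw [eq_bot_iff, ← htop, ← Submodule.iInf_orthogonal]
    intro v hv
    refine Submodule.mem_iInf _ |>.mpr fun i => ?_
    rw [← Submodule.orthogonalProjectionOnto_eq_zero_iff]
    refine eq_of_forall_repr_eq (b i) fun k => ?_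
    rw [map_zero, (b i).repr_apply_apply, hb,
      Submodule.inner_orthogonalProjectionOnto_eq_of_mem_left]
    exact Submodule.inner_right_of_mem_orthogonal
      (Submodule.subset_span (Set.mem_range_self (⟨i, k⟩ : Σ i, w i))) hv
  refine ⟨w, HilbertBasis.mkOfOrthogonalEqBot hortho hspan, fun k => ?_⟩
  rw [HilbertBasis.coe_mkOfOrthogonalEqBot]
  exact (k.2 : V k.1).2

end Restrict

section BoundedSelfAdjoint

universe u

variable {K : Type u} [NormedAddCommGroup K] [InnerProductSpace ℂ K] [CompleteSpace K]
variable {A : K →L[ℂ] K}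

theorem exists_hasEigenvalue_of_countable_spectrum [Nontrivial K] (hA : IsSelfAdjoint A)
    (hcount : (_root_.spectrum ℝ A).Countable) :
    ∃ r : ℝ, Module.End.HasEigenvalue (A : Module.End ℂ K) r := by
  obtain ⟨x, hx, hiso⟩ := exists_isolated_of_countable (spectrum.isClosed (𝕜 := ℝ) A)
    (ContinuousFunctionalCalculus.spectrum_nonempty A hA) hcount
  obtain ⟨w, hw⟩ := DFunLike.ne_iff.mp (cfc_indicator_singleton_ne_zero hA hx hiso)
  refine ⟨x, Module.End.hasEigenvalue_of_hasEigenvector (x := cfc (Set.indicator {x} 1) A w)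
    ⟨Module.End.mem_eigenspace_iff.mpr ?_, hw⟩⟩
  exact DFunLike.congr_fun (mul_cfc_indicator_singleton hA hiso) w

theorem countable_real_spectrum {A : Type*} [Ring A] [Algebra ℂ A] {a : A}
    (h : (_root_.spectrum ℂ a).Countable) : (_root_.spectrum ℝ a).Countable := by
  rw [← spectrum.preimage_algebraMap ℂ]
  exact h.preimage Complex.ofReal_injective

theorem orthogonal_iSup_eigenspace_eq_bot (hA : IsSelfAdjoint A)
    (hcount : (_root_.spectrum ℂ A).Countable) :
    (⨆ μ, Module.End.eigenspace (A : Module.End ℂ K) μ)ᗮ = ⊥ := by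
  have hsymm : (A : Module.End ℂ K).IsSymmetric :=
    ContinuousLinearMap.isSelfAdjoint_iff_isSymmetric.mp hA
  set N := (⨆ μ, Module.End.eigenspace (A : Module.End ℂ K) μ)ᗮ
  have hN : ∀ v ∈ N, A v ∈ N := hsymm.orthogonalComplement_iSup_eigenspaces_invariant
  by_contra hbot
  have : Nontrivial N := Submodule.nontrivial_iff_ne_bot.mpr hbot
  have hAN : IsSelfAdjoint (A.restrict hN) :=
    ContinuousLinearMap.isSelfAdjoint_iff_isSymmetric.mpr (hsymm.restrict_invariant hN)
  have hsub := spectrum_restrict_subset (commute_starProjection_of_isSelfAdjoint hA hN) hN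
  obtain ⟨r, hr⟩ := exists_hasEigenvalue_of_countable_spectrum hAN
    (countable_real_spectrum (hcount.mono hsub))
  exact hr (hsymm.orthogonalComplement_iSup_eigenspaces r)

theorem exists_eigenbasis_of_countable_spectrum (hA : IsSelfAdjoint A)
    (hcount : (_root_.spectrum ℂ A).Countable) :
    ∃ (ι : Type u) (b : HilbertBasis ι ℂ K) (r : ι → ℝ), ∀ i, A (b i) = (r i : ℂ) • b i := by
  have hsymm : (A : Module.End ℂ K).IsSymmetric :=
    ContinuousLinearMap.isSelfAdjoint_iff_isSymmetric.mp hA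
  have hclosed (μ : ℂ) : CompleteSpace (Module.End.eigenspace (A : Module.End ℂ K) μ) :=
    have hker : IsClosed (Module.End.eigenspace (A : Module.End ℂ K) μ : Set K) := by
      rw [Module.End.eigenspace_def]
      exact (A - algebraMap ℂ (K →L[ℂ] K) μ).isClosed_ker
    hker.completeSpace_coe
  obtain ⟨w, b, hb⟩ := exists_hilbertBasis_of_orthogonalFamily hsymm.orthogonalFamily_eigenspaces
    (orthogonal_iSup_eigenspace_eq_bot hA hcount)
  refine ⟨_, b, fun k => k.1.re, fun k => ?_⟩
  have hreal : ((k.1.re : ℝ) : ℂ) = k.1 := by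
    refine Complex.conj_eq_iff_re.mp (hsymm.conj_eigenvalue_eq_self ?_)
    exact Module.End.hasEigenvalue_of_hasEigenvector ⟨hb k, b.orthonormal.ne_zero k⟩
  rw [hreal]
  exact Module.End.mem_eigenspace_iff.mp (hb k)

end BoundedSelfAdjoint

/-! ### Resolvents -/

section Resolvent

universe u

variable {K : Type u} [NormedAddCommGroup K] [InnerProductSpace ℂ K]

/-- `R` is the resolvent `(H - z)⁻¹`. -/
def IsResolventAt (H : K →ₗ.[ℂ] K) (z : ℂ) (R : K →L[ℂ] K) : Prop :=
  (∀ w : K, ∃ h : R w ∈ H.domain, H ⟨R w, h⟩ - z • R w = w) ∧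
    ∀ x : H.domain, R (H x - z • (x : K)) = x

variable {H : K →ₗ.[ℂ] K} {z z' : ℂ} {R S : K →L[ℂ] K}

theorem mem_graph_iff_resolvent (hR : IsResolventAt H z R) {x y : K} :
    (x, y) ∈ H.graph ↔ R (y - z • x) = x := by
  constructor
  · intro h
    obtain ⟨ψ, rfl, rfl⟩ := (LinearPMap.mem_graph_iff _).mp h
    exact hR.2 ψ
  · intro h
    obtain ⟨hmem, hw⟩ := hR.1 (y - z • x)
    have hgraph := H.mem_graph ⟨R (y - z • x), hmem⟩
    rw [eq_add_of_sub_eq hw] at hgraph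
    simpa only [h, sub_add_cancel] using hgraph

theorem resolvent_mem_graph (hR : IsResolventAt H z R) (w : K) :
    (R w, w + z • R w) ∈ H.graph := by
  rw [mem_graph_iff_resolvent hR, add_sub_cancel_right]

theorem resolvent_sub_resolvent (hR : IsResolventAt H z R) (hS : IsResolventAt H z' S) :
    R - S = (z - z') • (R * S) := by
  ext w
  have h := (mem_graph_iff_resolvent hR).mp (resolvent_mem_graph hS w)
  rw [add_sub_assoc, ← sub_smul, map_add, map_smul] at h
  change R w - S w = (z - z') • R (S w)
  linear_combination (norm := module) h

theorem notMem_spectrum_resolvent {m : ℂ} (hm : m ≠ 0) (hR : IsResolventAt H z R)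
    (hS : IsResolventAt H (z + m⁻¹) S) : m ∉ _root_.spectrum ℂ R := by
  have hRS : R * S = m • (S - R) := by
    rw [← neg_sub R S, resolvent_sub_resolvent hR hS, sub_add_cancel_left, neg_smul, neg_neg,
      smul_inv_smul₀ hm]
  have hSR : S * R = m • (S - R) := by
    rw [resolvent_sub_resolvent hS hR, add_sub_cancel_left, smul_inv_smul₀ hm]
  rw [spectrum.notMem_iff, Algebra.algebraMap_eq_smul_one]
  -- `(m - R)⁻¹ = m⁻¹ + m⁻² (H - (z + m⁻¹))⁻¹`
  refine ⟨⟨m • 1 - R, m⁻¹ • 1 + (m⁻¹ * m⁻¹) • S, ?_, ?_⟩, rfl⟩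
  · simp only [sub_mul, mul_add, smul_mul_assoc, mul_smul_comm, one_mul, mul_one, hRS]
    match_scalars <;> field_simp <;> ring
  · simp only [mul_sub, add_mul, smul_mul_assoc, mul_smul_comm, one_mul, mul_one, hSR]
    match_scalars <;> field_simp <;> ring

theorem countable_spectrum_resolvent (hR : IsResolventAt H z R) (hσ : (spectrum H).Countable) :
    (_root_.spectrum ℂ R).Countable := by
  have hsub : _root_.spectrum ℂ R ⊆ {0} ∪ (fun m => z + m⁻¹) ⁻¹' spectrum H := by
    intro m hm
    refine or_iff_not_imp_left.mpr fun hm0 hres => ?_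
    obtain ⟨S, hS⟩ := hres
    exact notMem_spectrum_resolvent hm0 hR hS hm
  have hinj : Function.Injective fun m : ℂ => z + m⁻¹ :=
    (add_right_injective z).comp inv_injective
  exact ((Set.countable_singleton 0).union (hσ.preimage hinj)).mono hsub

theorem mem_graph_of_resolvent_eq_smul (hR : IsResolventAt H z R) {r : ℂ} {v : K} (hv : v ≠ 0)
    (hRv : R v = r • v) : (v, (z + r⁻¹) • v) ∈ H.graph := by
  have hr : r ≠ 0 := by
    rintro rfl
    have hgraph := resolvent_mem_graph hR v
    rw [hRv, zero_smul, smul_zero, add_zero] at hgraph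
    exact hv (H.graph_fst_eq_zero_snd hgraph rfl)
  rw [mem_graph_iff_resolvent hR, add_smul, add_sub_cancel_left, map_smul, hRv,
    inv_smul_smul₀ hr]

theorem exists_real_mem_resolventSet (hσ : (spectrum H).Countable) :
    ∃ x : ℝ, (x : ℂ) ∈ resolventSet H := by
  have hcount : (((↑) : ℝ → ℂ) ⁻¹' spectrum H).Countable := hσ.preimage Complex.ofReal_injective
  obtain ⟨x, hx⟩ := hcount.dense_compl ℝ |>.nonempty
  exact ⟨x, not_not.mp hx⟩

variable [CompleteSpace K]

theorem isSelfAdjoint_resolvent {x : ℝ} (hH : H.IsFormalAdjoint H) (hR : IsResolventAt H x R) :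
    IsSelfAdjoint R := by
  refine ContinuousLinearMap.isSelfAdjoint_iff_isSymmetric.mpr fun v w => ?_
  obtain ⟨hv, hv'⟩ := hR.1 v
  obtain ⟨hw, hw'⟩ := hR.1 w
  have hsymm : inner ℂ (H ⟨R v, hv⟩) (R w) = inner ℂ (R v) (H ⟨R w, hw⟩) := hH ⟨R v, hv⟩ ⟨R w, hw⟩
  calc inner ℂ (R v) w = inner ℂ (R v) (H ⟨R w, hw⟩ - (x : ℂ) • R w) := by rw [hw']
    _ = inner ℂ (H ⟨R v, hv⟩ - (x : ℂ) • R v) (R w) := by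
      rw [inner_sub_right, inner_sub_left, inner_smul_left, inner_smul_right, Complex.conj_ofReal,
        hsymm]
    _ = inner ℂ v (R w) := by rw [hv']

theorem exists_eq_diagOp_of_countable_spectrum (hH : IsSelfAdjoint H)
    (hσ : (spectrum H).Countable) :
    ∃ (ι : Type u) (b : HilbertBasis ι ℂ K) (l : ι → ℝ), H = diagOp b l := by
  obtain ⟨x, R, hR⟩ := exists_real_mem_resolventSet hσ
  have hRsa := isSelfAdjoint_resolvent (isFormalAdjoint_of_isSelfAdjoint hH) hR
  obtain ⟨ι, b, r, hb⟩ :=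
    exists_eigenbasis_of_countable_spectrum hRsa (countable_spectrum_resolvent hR hσ)
  refine ⟨ι, b, fun i => x + (r i)⁻¹, eq_diagOp_of_eigenbasis b hH fun i => ?_⟩
  push_cast
  exact mem_graph_of_resolvent_eq_smul hR (b.orthonormal.ne_zero i) (hb i)

end Resolvent

/-! ### The Gaussian -/

section Gaussian

variable (V : Type*) [NormedAddCommGroup V] [InnerProductSpace ℝ V]

theorem exists_pow_mul_exp_neg_le (k : ℕ) :
    ∃ C : ℝ, ∀ t : ℝ, 0 ≤ t → (1 + t) ^ k * Real.exp (-(t ^ 2 / 2)) ≤ C := by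
  refine ⟨k.factorial * Real.exp 2, fun t ht => ?_⟩
  have hpow : (1 + t) ^ k ≤ k.factorial * Real.exp (1 + t) := by
    have h := Real.pow_div_factorial_le_exp (1 + t) (by positivity) k
    rwa [div_le_iff₀ (by positivity), mul_comm] at h
  calc (1 + t) ^ k * Real.exp (-(t ^ 2 / 2))
      ≤ k.factorial * Real.exp (1 + t) * Real.exp (-(t ^ 2 / 2)) := by gcongr
    _ = k.factorial * Real.exp (1 + t - t ^ 2 / 2) := by
      rw [mul_assoc, ← Real.exp_add, sub_eq_add_neg]
    _ ≤ k.factorial * Real.exp 2 := by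
      gcongr
      nlinarith [sq_nonneg (t - 1)]

theorem norm_iteratedFDeriv_exp (i : ℕ) (t : ℝ) :
    ‖iteratedFDeriv ℝ i Real.exp t‖ = Real.exp t := by
  rw [norm_iteratedFDeriv_eq_norm_iteratedDeriv, iteratedDeriv_eq_iterate, Real.iter_deriv_exp,
    Real.norm_eq_abs, Real.abs_exp]

theorem exists_norm_iteratedFDeriv_exp_comp_le {V : Type*} [NormedAddCommGroup V]
    [NormedSpace ℝ V] {f : V → ℝ} (hf : f.HasTemperateGrowth) (i : ℕ) :
    ∃ (q : ℕ) (C : ℝ), 0 ≤ C ∧ ∀ x,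
      ‖iteratedFDeriv ℝ i (fun x => Real.exp (f x)) x‖ ≤
        C * (1 + ‖x‖) ^ q * Real.exp (f x) := by
  obtain ⟨q, B, hB0, hB⟩ := hf.norm_iteratedFDeriv_le_uniform i
  refine ⟨q * i, i.factorial * (1 + B) ^ i, by positivity, fun x => ?_⟩
  have hone : 1 ≤ (1 + B) * (1 + ‖x‖) ^ q := by
    have : 1 ≤ (1 + ‖x‖) ^ q := one_le_pow₀ (by linarith [norm_nonneg x])
    nlinarith
  have hderiv (j : ℕ) (hj : 1 ≤ j) (hji : j ≤ i) :
      ‖iteratedFDeriv ℝ j f x‖ ≤ ((1 + B) * (1 + ‖x‖) ^ q) ^ j := by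
    refine (hB j hji x).trans (le_trans ?_ (le_self_pow₀ hone (by lia)))
    gcongr
    linarith
  have hcomp := norm_iteratedFDeriv_comp_le (𝕜 := ℝ) (n := i) (N := i) Real.contDiff_exp
    (hf.1.of_le (by exact_mod_cast le_top)) le_rfl x
    (fun j _ => (norm_iteratedFDeriv_exp j (f x)).le) hderiv
  refine hcomp.trans_eq ?_
  rw [mul_pow, ← pow_mul]
  ring

theorem hasTemperateGrowth_neg_norm_sq_div_two :
    (fun x : V => -(‖x‖ ^ 2 / 2)).HasTemperateGrowth := by
  convert! (Function.HasTemperateGrowth.const (E := V) (-(1 / 2) : ℝ)).mul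
    (Function.hasTemperateGrowth_norm_sq V) using 1
  ext x
  simp only [Pi.mul_apply]
  ring

theorem exists_norm_iteratedFDeriv_gaussian_le (k i : ℕ) :
    ∃ C : ℝ, ∀ x : V,
      ‖x‖ ^ k * ‖iteratedFDeriv ℝ i (fun x : V => Real.exp (-(‖x‖ ^ 2 / 2))) x‖ ≤ C := by
  obtain ⟨q, B, hB0, hB⟩ :=
    exists_norm_iteratedFDeriv_exp_comp_le (hasTemperateGrowth_neg_norm_sq_div_two V) i
  obtain ⟨C, hC⟩ := exists_pow_mul_exp_neg_le (k + q)
  refine ⟨B * C, fun x => ?_⟩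
  calc ‖x‖ ^ k * ‖iteratedFDeriv ℝ i (fun x : V => Real.exp (-(‖x‖ ^ 2 / 2))) x‖
      ≤ (1 + ‖x‖) ^ k * (B * (1 + ‖x‖) ^ q * Real.exp (-(‖x‖ ^ 2 / 2))) := by
        gcongr
        · linarith
        · exact hB x
    _ = B * ((1 + ‖x‖) ^ (k + q) * Real.exp (-(‖x‖ ^ 2 / 2))) := by ring
    _ ≤ B * C := by
        gcongr
        exact hC _ (norm_nonneg x)

theorem contDiff_exp_neg_norm_sq_div_two :
    ContDiff ℝ ∞ fun x : V => Real.exp (-(‖x‖ ^ 2 / 2)) :=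
  Real.contDiff_exp.comp (hasTemperateGrowth_neg_norm_sq_div_two V).1

/-- The Gaussian `exp (-‖x‖² / 2)` as a Schwartz function: the ground state of the harmonic
oscillator. -/
def gaussian : 𝓢(V, ℂ) where
  toFun x := ((Real.exp (-(‖x‖ ^ 2 / 2)) : ℝ) : ℂ)
  smooth' := Complex.ofRealCLM.contDiff.comp (contDiff_exp_neg_norm_sq_div_two V)
  decay' k i := by
    obtain ⟨C, hC⟩ := exists_norm_iteratedFDeriv_gaussian_le V k i
    refine ⟨C, fun x => ?_⟩
    have hsmooth := (contDiff_exp_neg_norm_sq_div_two V).contDiffAt (x := x)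
    exact (congrArg _ (Complex.ofRealLI.norm_iteratedFDeriv_comp_left (i := i) hsmooth
      (by exact_mod_cast le_top))).trans_le (hC x)

@[simp]
theorem gaussian_apply (x : V) : gaussian V x = ((Real.exp (-(‖x‖ ^ 2 / 2)) : ℝ) : ℂ) := rfl

end Gaussian

/-! ### Ladder operators -/

section Ladder

variable {n : ℕ}

local notation "𝒮" => 𝓢(EuclideanSpace ℝ (Fin n), ℂ)

theorem commute_position (j k : Fin n) : Commute (position (n := n) j) (position k) := by
  ext φ x
  simp only [Module.End.mul_apply, position_apply]
  ring

theorem momentum_momentum_apply (j k : Fin n) (φ : 𝒮) (x : EuclideanSpace ℝ (Fin n)) :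
    momentum j (momentum k φ) x =
      -fderiv ℝ (fderiv ℝ φ) x (EuclideanSpace.single j 1) (EuclideanSpace.single k 1) := by
  have hdiff : DifferentiableAt ℝ (fderiv ℝ φ) x :=
    ((φ.smooth 2).fderiv_right (m := 1) (by norm_num)).differentiable one_ne_zero x
  have hderiv := (hdiff.hasFDerivAt.clm_apply
    (hasFDerivAt_const (EuclideanSpace.single k (1 : ℝ)) x)).const_mul (-Complex.I)
  have hfun : ⇑(momentum k φ) = fun y => -Complex.I * fderiv ℝ φ y (EuclideanSpace.single k 1) :=
    funext (momentum_apply k φ)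
  rw [momentum_apply, hfun, hderiv.fderiv]
  simp [← mul_assoc]

theorem commute_momentum (j k : Fin n) : Commute (momentum (n := n) j) (momentum k) := by
  ext φ x
  have hsymm : IsSymmSndFDerivAt ℝ φ x := (φ.smooth 2).contDiffAt.isSymmSndFDerivAt (by simp)
  rw [Module.End.mul_apply, Module.End.mul_apply, momentum_momentum_apply,
    momentum_momentum_apply, hsymm.eq]

theorem momentum_mul_position (j k : Fin n) :
    momentum (n := n) j * position k =
      position k * momentum j - (if j = k then Complex.I else 0) • 1 := by
  ext φ x
  have hcoord : HasFDerivAt (fun x : EuclideanSpace ℝ (Fin n) => ((x k : ℝ) : ℂ))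
      (Complex.ofRealCLM.comp (EuclideanSpace.proj (𝕜 := ℝ) k)) x :=
    (Complex.ofRealCLM.comp (EuclideanSpace.proj (𝕜 := ℝ) k)).hasFDerivAt
  have hfun : ⇑(position k φ) = (fun x => ((x k : ℝ) : ℂ)) * ⇑φ := funext (position_apply k φ)
  rw [Module.End.mul_apply, LinearMap.sub_apply, LinearMap.smul_apply, Module.End.mul_apply,
    Module.End.one_apply, momentum_apply, hfun, (hcoord.mul (φ.hasFDerivAt x)).fderiv]
  simp only [sub_apply, smul_apply, position_apply, momentum_apply]
  by_cases hjk : j = k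
  · simp [hjk]
    ring
  · simp [hjk, Ne.symm hjk]
    ring

/-- The annihilation operator `X_j + i P_j`, without the customary factor `1 / √2`. -/
def lower (j : Fin n) : Module.End ℂ 𝒮 := position j + Complex.I • momentum j

/-- The creation operator `X_j - i P_j`, without the customary factor `1 / √2`. -/
def raise (j : Fin n) : Module.End ℂ 𝒮 := position j - Complex.I • momentum j

/-- The number operator `(X_j² + P_j² - 1) / 2` of the `j`-th degree of freedom. -/
def number (j : Fin n) : Module.End ℂ 𝒮 := (2⁻¹ : ℂ) • (raise j * lower j)

theorem commute_raise (j k : Fin n) : Commute (raise (n := n) j) (raise k) := by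
  rw [commute_iff_eq]
  simp only [raise, sub_mul, mul_sub, smul_mul_assoc, mul_smul_comm, (commute_position j k).eq,
    (commute_momentum j k).eq, momentum_mul_position j k, momentum_mul_position k j,
    eq_comm (a := k)]
  module

theorem lower_mul_raise (j k : Fin n) :
    lower (n := n) k * raise j = raise j * lower k + (if j = k then 2 else 0 : ℂ) • 1 := by
  simp only [raise, lower, sub_mul, mul_sub, add_mul, mul_add, smul_mul_assoc, mul_smul_comm,
    (commute_position k j).eq, (commute_momentum k j).eq, momentum_mul_position j k,
    momentum_mul_position k j, eq_comm (a := k)]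
  split_ifs
  · linear_combination (norm := module) (-(2 : ℂ) * Complex.I_mul_I) • (1 : Module.End ℂ 𝒮)
  · module

theorem number_mul_raise (j k : Fin n) :
    number (n := n) k * raise j =
      raise j * number k + (if j = k then 1 else 0 : ℂ) • raise j := by
  rw [number, smul_mul_assoc, mul_assoc, lower_mul_raise, mul_add, mul_smul_comm, mul_one,
    ← mul_assoc, (commute_raise k j).eq, mul_assoc, mul_smul_comm]
  split_ifs with hjk
  · subst hjk
    module
  · module

theorem two_smul_number (j : Fin n) :
    (2 : ℂ) • number (n := n) j = position j ^ 2 + momentum j ^ 2 - 1 := by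
  have hcomm := momentum_mul_position (n := n) j j
  rw [if_pos rfl] at hcomm
  simp only [number, raise, lower, sub_mul, mul_add, smul_mul_assoc, mul_smul_comm, hcomm, sq]
  have hI := Complex.I_mul_I
  linear_combination (norm := module) hI • (1 : Module.End ℂ 𝒮) - hI • (momentum j * momentum j)

theorem lower_gaussian (j : Fin n) : lower j (gaussian (EuclideanSpace ℝ (Fin n))) = 0 := by
  ext x
  have hexp : HasFDerivAt (fun x : EuclideanSpace ℝ (Fin n) => Real.exp (-(2⁻¹ * ‖x‖ ^ 2))) _ x :=
    ((hasStrictFDerivAt_norm_sq x).hasFDerivAt.const_mul 2⁻¹).neg.exp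
  have hfun : ⇑(gaussian (EuclideanSpace ℝ (Fin n))) =
      Complex.ofRealCLM ∘ fun x => Real.exp (-(2⁻¹ * ‖x‖ ^ 2)) := by
    ext y
    simp [div_eq_inv_mul]
  rw [lower, LinearMap.add_apply, LinearMap.smul_apply, add_apply, smul_apply, position_apply,
    momentum_apply, hfun,
    (Complex.ofRealCLM.hasFDerivAt.comp x hexp).fderiv]
  simp [← mul_assoc, EuclideanSpace.inner_single_right]
  ring

end Ladder

section Symmetry

variable {n : ℕ}

local notation "𝒮" => 𝓢(EuclideanSpace ℝ (Fin n), ℂ)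

theorem toLp_smul (c : ℂ) (φ : 𝒮) : (c • φ).toLp 2 volume = (c • φ.toLp 2 volume : L2 n) := rfl

theorem inner_toLp (φ ψ : 𝒮) :
    inner ℂ (φ.toLp 2 volume) (ψ.toLp 2 volume) = ∫ x, starRingEnd ℂ (φ x) * ψ x := by
  rw [SchwartzMap.inner_toL2_toL2_eq _ _ volume]
  simp [RCLike.inner_apply, mul_comm]

theorem inner_position (j : Fin n) (φ ψ : 𝒮) :
    inner ℂ ((position j φ).toLp 2 volume) (ψ.toLp 2 volume) =
      inner ℂ (φ.toLp 2 volume) ((position j ψ).toLp 2 volume) := by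
  rw [inner_toLp, inner_toLp]
  refine integral_congr_ae (.of_forall fun x => ?_)
  simp only [position_apply, map_mul, Complex.conj_ofReal]
  ring

theorem inner_momentum (j : Fin n) (φ ψ : 𝒮) :
    inner ℂ ((momentum j φ).toLp 2 volume) (ψ.toLp 2 volume) =
      inner ℂ (φ.toLp 2 volume) ((momentum j ψ).toLp 2 volume) := by
  let e : EuclideanSpace ℝ (Fin n) := EuclideanSpace.single j 1
  have hparts : ∫ x, starRingEnd ℂ (φ x) * fderiv ℝ ψ x e =
      -∫ x, starRingEnd ℂ (fderiv ℝ φ x e) * ψ x := by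
    have h := SchwartzMap.integral_bilinear_lineDerivOp_right_eq_neg_left (μ := volume) φ ψ
      ((ContinuousLinearMap.mul ℝ ℂ).comp (Complex.conjCLE : ℂ →L[ℝ] ℂ)) e
    simp only [SchwartzMap.lineDerivOp_apply_eq_fderiv] at h
    exact h
  rw [inner_toLp, inner_toLp]
  simp only [momentum_apply, map_mul, map_neg, Complex.conj_I, neg_neg, mul_assoc,
    mul_left_comm _ (-Complex.I), integral_const_mul]
  rw [hparts, neg_mul_neg]

theorem inner_lower (j : Fin n) (φ ψ : 𝒮) :
    inner ℂ ((lower j φ).toLp 2 volume) (ψ.toLp 2 volume) =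
      inner ℂ (φ.toLp 2 volume) ((raise j ψ).toLp 2 volume) := by
  have hlower : (lower j φ).toLp 2 volume =
      ((position j φ).toLp 2 volume + Complex.I • (momentum j φ).toLp 2 volume : L2 n) := rfl
  have hraise : (raise j ψ).toLp 2 volume =
      ((position j ψ).toLp 2 volume - Complex.I • (momentum j ψ).toLp 2 volume : L2 n) := rfl
  rw [hlower, hraise, inner_add_left, inner_sub_right, inner_smul_left, inner_smul_right,
    inner_position, inner_momentum, Complex.conj_I]
  ring

theorem inner_raise (j : Fin n) (φ ψ : 𝒮) :
    inner ℂ ((raise j φ).toLp 2 volume) (ψ.toLp 2 volume) =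
      inner ℂ (φ.toLp 2 volume) ((lower j ψ).toLp 2 volume) := by
  rw [← inner_conj_symm, ← inner_lower, inner_conj_symm]

theorem inner_number (j : Fin n) (φ ψ : 𝒮) :
    inner ℂ ((number j φ).toLp 2 volume) (ψ.toLp 2 volume) =
      inner ℂ (φ.toLp 2 volume) ((number j ψ).toLp 2 volume) := by
  have hnumber (χ : 𝒮) : (number j χ).toLp 2 volume =
      ((2⁻¹ : ℂ) • (raise j (lower j χ)).toLp 2 volume : L2 n) := rfl
  rw [hnumber, hnumber, inner_smul_left, inner_smul_right, inner_raise, inner_lower, map_inv₀,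
    Complex.conj_ofNat]

end Symmetry

/-! ### Hermite functions -/

section Hermite

variable {n : ℕ}

local notation "𝒮" => 𝓢(EuclideanSpace ℝ (Fin n), ℂ)

theorem pairwise_commute_powersHom_raise :
    Pairwise fun j k : Fin n => ∀ x y, Commute (powersHom (Module.End ℂ 𝒮) (raise j) x)
      (powersHom (Module.End ℂ 𝒮) (raise k) y) := by
  intro j k _ x y
  simpa only [powersHom_apply] using (commute_raise j k).pow_pow _ _

/-- The product `∏ j, (X_j - i P_j) ^ (m j)` of powers of creation operators, as a homomorphism
in the multi-index `m`. -/
def raisePow : (Fin n → Multiplicative ℕ) →* Module.End ℂ 𝒮 :=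
  MonoidHom.noncommPiCoprod (fun j => powersHom _ (raise j)) pairwise_commute_powersHom_raise

/-- The unnormalized Hermite function of multi-index `m`: creation operators applied to the
Gaussian. -/
def hermite (m : Fin n → ℕ) : 𝒮 :=
  raisePow (fun j => Multiplicative.ofAdd (m j)) (gaussian _)

theorem hermite_zero : hermite (0 : Fin n → ℕ) = gaussian _ :=
  DFunLike.congr_fun (map_one raisePow) (gaussian _)

theorem hermite_add_single (m : Fin n → ℕ) (j : Fin n) :
    hermite (m + Pi.single j 1) = raise j (hermite m) := by
  have hmul : (fun k => Multiplicative.ofAdd ((m + Pi.single j 1 : Fin n → ℕ) k)) =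
      Pi.mulSingle j (Multiplicative.ofAdd 1) * fun k => Multiplicative.ofAdd (m k) := by
    ext k
    rcases eq_or_ne k j with rfl | hk
    · simp [mul_comm]
    · simp [hk]
  rw [hermite, hmul, map_mul, Module.End.mul_apply, hermite, raisePow,
    MonoidHom.noncommPiCoprod_mulSingle, powersHom_apply, toAdd_ofAdd, pow_one]

theorem multiIndex_induction {ι : Type*} [Finite ι] [DecidableEq ι] {p : (ι → ℕ) → Prop}
    (zero : p 0) (add_single : ∀ m j, p m → p (m + Pi.single j 1)) (m : ι → ℕ) : p m := by
  have add_single_nsmul (j : ι) (k : ℕ) {m : ι → ℕ} (hm : p m) : p (m + Pi.single j k) := by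
    induction k with
    | zero => simpa using hm
    | succ k ih => simpa only [Pi.single_add, add_assoc] using add_single _ j ih
  have add (m' : ι → ℕ) : ∀ m, p m → p (m + m') :=
    Pi.single_induction (fun m' => ∀ m, p m → p (m + m')) m' (fun m hm => by rwa [add_zero])
      (fun f g hf hg m hm => by simpa only [add_assoc] using hg _ (hf m hm))
      fun j k m hm => add_single_nsmul j k hm
  simpa only [zero_add] using add m 0 zero

theorem number_hermite (k : Fin n) (m : Fin n → ℕ) :
    number k (hermite m) = (m k : ℂ) • hermite m := by
  induction m using multiIndex_induction with
  | zero => simp [hermite_zero, number, lower_gaussian]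
  | add_single m j ih =>
    have h := LinearMap.congr_fun (number_mul_raise j k) (hermite m)
    simp only [Module.End.mul_apply, LinearMap.add_apply, LinearMap.smul_apply, ih, map_smul] at h
    rw [hermite_add_single, h]
    rcases eq_or_ne j k with rfl | hjk
    · simp [add_smul]
    · simp [hjk, hjk.symm]

theorem lower_raise_hermite (j : Fin n) (m : Fin n → ℕ) :
    lower j (raise j (hermite m)) = (2 * (m j + 1) : ℂ) • hermite m := by
  have hcomm := LinearMap.congr_fun (lower_mul_raise j j) (hermite m)
  have hnumber : raise j (lower j (hermite m)) = (2 : ℂ) • number j (hermite m) := by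
    rw [number, LinearMap.smul_apply, smul_inv_smul₀ two_ne_zero, Module.End.mul_apply]
  simp only [Module.End.mul_apply, LinearMap.add_apply, LinearMap.smul_apply, if_true,
    Module.End.one_apply, hnumber, number_hermite] at hcomm
  rw [hcomm]
  module

theorem hermite_ne_zero (m : Fin n → ℕ) : hermite m ≠ 0 := by
  induction m using multiIndex_induction with
  | zero =>
    intro h
    simpa [hermite_zero] using DFunLike.congr_fun h 0
  | add_single m j ih =>
    intro h
    have hlower := lower_raise_hermite j m
    rw [← hermite_add_single, h, map_zero, eq_comm, smul_eq_zero] at hlower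
    exact hlower.elim (by norm_cast) ih

theorem toLp_hermite_ne_zero (m : Fin n → ℕ) : ((hermite m).toLp 2 volume : L2 n) ≠ 0 :=
  fun h => hermite_ne_zero m (SchwartzMap.injective_toLp 2 volume h)

/-- The Hermite function of multi-index `m`, normalized in `L²`. -/
def hermiteFun (m : Fin n → ℕ) : 𝒮 :=
  ((‖((hermite m).toLp 2 volume : L2 n)‖⁻¹ : ℝ) : ℂ) • hermite m

theorem number_hermiteFun (k : Fin n) (m : Fin n → ℕ) :
    number k (hermiteFun m) = (m k : ℂ) • hermiteFun m := by
  rw [hermiteFun, map_smul, number_hermite, smul_comm]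

theorem orthonormal_hermiteFun :
    Orthonormal ℂ fun m : Fin n → ℕ => ((hermiteFun m).toLp 2 volume : L2 n) := by
  constructor
  · intro m
    simp only [hermiteFun]
    rw [toLp_smul, norm_smul, Complex.norm_real, norm_inv, norm_norm,
      inv_mul_cancel₀ (norm_ne_zero_iff.mpr (toLp_hermite_ne_zero m))]
  · intro m m' hne
    obtain ⟨j, hj⟩ := Function.ne_iff.mp hne
    -- Eigenvectors of the symmetric operator `number j` for the eigenvalues `m j ≠ m' j`.
    have h := inner_number j (hermiteFun m) (hermiteFun m')
    rw [number_hermiteFun, number_hermiteFun, toLp_smul, toLp_smul, inner_smul_left,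
      inner_smul_right, Complex.conj_natCast] at h
    exact (mul_eq_mul_right_iff.mp h).resolve_left fun heq => hj (Nat.cast_injective heq)

/-- The linear span of the Hermite functions, that is, the products of the Gaussian with
polynomials. -/
def hermiteSpan (n : ℕ) : Submodule ℂ 𝓢(EuclideanSpace ℝ (Fin n), ℂ) :=
  Submodule.span ℂ (Set.range hermite)

theorem hermite_mem_hermiteSpan (m : Fin n → ℕ) : hermite m ∈ hermiteSpan n :=
  Submodule.subset_span ⟨m, rfl⟩

theorem raise_mem_hermiteSpan (j : Fin n) {φ : 𝒮} (hφ : φ ∈ hermiteSpan n) :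
    raise j φ ∈ hermiteSpan n := by
  suffices h : hermiteSpan n ≤ (hermiteSpan n).comap (raise j) from h hφ
  refine Submodule.span_le.mpr (Set.range_subset_iff.mpr fun m => ?_)
  rw [SetLike.mem_coe, Submodule.mem_comap, ← hermite_add_single]
  exact hermite_mem_hermiteSpan _

theorem lower_mem_hermiteSpan (j : Fin n) {φ : 𝒮} (hφ : φ ∈ hermiteSpan n) :
    lower j φ ∈ hermiteSpan n := by
  suffices h : hermiteSpan n ≤ (hermiteSpan n).comap (lower j) from h hφ
  refine Submodule.span_le.mpr (Set.range_subset_iff.mpr fun m => ?_)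
  rw [SetLike.mem_coe, Submodule.mem_comap]
  induction m using multiIndex_induction with
  | zero =>
    rw [hermite_zero, lower_gaussian]
    exact Submodule.zero_mem _
  | add_single m k ih =>
    have hcomm := LinearMap.congr_fun (lower_mul_raise k j) (hermite m)
    rw [hermite_add_single, ← Module.End.mul_apply, hcomm]
    exact Submodule.add_mem _ (raise_mem_hermiteSpan k ih)
      (Submodule.smul_mem _ _ (hermite_mem_hermiteSpan m))

theorem position_mem_hermiteSpan (j : Fin n) {φ : 𝒮} (hφ : φ ∈ hermiteSpan n) :
    position j φ ∈ hermiteSpan n := by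
  have hposition : position j φ = (2⁻¹ : ℂ) • (lower j φ + raise j φ) := by
    simp only [lower, raise, LinearMap.add_apply, LinearMap.sub_apply, LinearMap.smul_apply]
    module
  rw [hposition]
  exact Submodule.smul_mem _ _
    (Submodule.add_mem _ (lower_mem_hermiteSpan j hφ) (raise_mem_hermiteSpan j hφ))

theorem exists_mem_hermiteSpan_eq_inner_pow_mul_gaussian (ξ : EuclideanSpace ℝ (Fin n)) (k : ℕ) :
    ∃ φ ∈ hermiteSpan n, ∀ x, φ x = ((inner ℝ ξ x : ℝ) : ℂ) ^ k * gaussian _ x := by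
  induction k with
  | zero => exact ⟨gaussian _, hermite_zero (n := n) ▸ hermite_mem_hermiteSpan 0, by simp⟩
  | succ k ih =>
    obtain ⟨φ, hφ, hpow⟩ := ih
    refine ⟨∑ j, ((ξ j : ℝ) : ℂ) • position j φ, Submodule.sum_mem _ fun j _ =>
      Submodule.smul_mem _ _ (position_mem_hermiteSpan j hφ), fun x => ?_⟩
    simp only [sum_apply, smul_apply, position_apply, hpow, smul_eq_mul]
    rw [pow_succ', PiLp.inner_apply]
    push_cast
    rw [Finset.sum_mul, Finset.sum_mul]
    refine Finset.sum_congr rfl fun j _ => ?_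
    rw [RCLike.inner_apply, RCLike.conj_to_real]
    push_cast
    ring

end Hermite

/-! ### Completeness of the Hermite functions -/

section Moments

open scoped FourierTransform RealInnerProductSpace

theorem integral_exp_mul_eq_zero_of_moments_eq_zero {α : Type*} [MeasurableSpace α] {μ : Measure α}
    {u h : α → ℂ} (hu : AEStronglyMeasurable u μ) (hh : AEStronglyMeasurable h μ)
    (hint : Integrable (fun x => Real.exp ‖u x‖ * ‖h x‖) μ)
    (hmoment : ∀ k : ℕ, ∫ x, u x ^ k * h x ∂μ = 0) : ∫ x, Complex.exp (u x) * h x ∂μ = 0 := by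
  let F (k : ℕ) (x : α) : ℂ := u x ^ k / k.factorial * h x
  let bound (k : ℕ) (x : α) : ℝ := ‖u x‖ ^ k / k.factorial * ‖h x‖
  have hF_le (k : ℕ) (x : α) : ‖F k x‖ ≤ bound k x := by
    simp only [F, bound, norm_mul, norm_div, norm_pow, Complex.norm_natCast, le_refl]
  have hasSum_F (x : α) : HasSum (F · x) (Complex.exp (u x) * h x) := by
    refine HasSum.mul_right _ ?_
    rw [Complex.exp_eq_exp_ℂ]
    exact NormedSpace.expSeries_div_hasSum_exp _
  have hasSum_bound (x : α) : HasSum (bound · x) (Real.exp ‖u x‖ * ‖h x‖) := by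
    refine HasSum.mul_right _ ?_
    rw [Real.exp_eq_exp_ℝ]
    exact NormedSpace.expSeries_div_hasSum_exp _
  have hintegral (k : ℕ) : ∫ x, F k x ∂μ = 0 := by
    simp only [F, div_mul_eq_mul_div, integral_div, hmoment, zero_div]
  have hsum : HasSum (fun k => ∫ x, F k x ∂μ) (∫ x, Complex.exp (u x) * h x ∂μ) :=
    hasSum_integral_of_dominated_convergence bound
      (fun k => (by fun_prop)) (fun k => ae_of_all _ (hF_le k))
      (ae_of_all _ fun x => (hasSum_bound x).summable)
      (by simpa only [(hasSum_bound _).tsum_eq] using hint) (ae_of_all _ hasSum_F)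
  simp only [hintegral] at hsum
  exact hsum.unique hasSum_zero

variable {V : Type*} [NormedAddCommGroup V] [InnerProductSpace ℝ V] [FiniteDimensional ℝ V]
  [MeasurableSpace V] [BorelSpace V] {h : V → ℂ}

theorem ae_eq_zero_of_fourier_eq_zero (hh : Integrable h) (hfourier : ∀ w, 𝓕 h w = 0) :
    ∀ᵐ x, h x = 0 := by
  refine ae_eq_zero_of_integral_contDiff_smul_eq_zero hh.locallyIntegrable fun g hg hgc => ?_
  -- The test function `g` is the Fourier transform of a Schwartz function, and `𝓕` is symmetric.
  let G : 𝓢(V, ℂ) := (hgc.comp_left Complex.ofReal_zero).toSchwartzMap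
    (Complex.ofRealCLM.contDiff.comp hg)
  have hG (x : V) : 𝓕 (𝓕⁻ G) x = (g x : ℂ) := by
    rw [FourierTransform.fourier_fourierInv_eq]
    rfl
  have hswap : ∫ ξ, 𝓕 (𝓕⁻ G) ξ * h ξ = ∫ x, (𝓕⁻ G) x * 𝓕 h x := by
    have := VectorFourier.integral_bilin_fourierIntegral_eq_flip (ContinuousLinearMap.mul ℂ ℂ)
      (L := innerₗ V) Real.continuous_fourierChar continuous_inner
      ((𝓕⁻ G).integrable (μ := volume)) hh
    rw [flip_innerₗ] at this
    exact this
  simpa only [hG, hfourier, mul_zero, integral_zero, Complex.real_smul] using hswap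

theorem fourier_eq_zero_of_moments_eq_zero (hh : AEStronglyMeasurable h)
    (hint : ∀ ξ : V, Integrable fun x => Real.exp |⟪ξ, x⟫| * ‖h x‖)
    (hmoment : ∀ (ξ : V) (k : ℕ), ∫ x, (⟪ξ, x⟫ : ℂ) ^ k * h x = 0) (w : V) : 𝓕 h w = 0 := by
  have hphase (x : V) : ((-2 * Real.pi * ⟪x, w⟫ : ℝ) : ℂ) * Complex.I =
      -Complex.I * (⟪(2 * Real.pi) • w, x⟫ : ℂ) := by
    rw [real_inner_smul_left, real_inner_comm]
    push_cast
    ring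
  simp only [Real.fourier_eq', hphase, smul_eq_mul]
  refine integral_exp_mul_eq_zero_of_moments_eq_zero (by fun_prop) hh ?_ fun k => ?_
  · simpa using hint ((2 * Real.pi) • w)
  · simp only [mul_pow, mul_assoc, integral_const_mul, hmoment, mul_zero]

end Moments

section Completeness

open scoped FourierTransform RealInnerProductSpace

variable {n : ℕ}

theorem memLp_exp_inner_mul_gaussian (ξ : EuclideanSpace ℝ (Fin n)) :
    MemLp (fun x : EuclideanSpace ℝ (Fin n) => Real.exp ⟪ξ, x⟫ * ‖gaussian _ x‖) 2 := by
  rw [memLp_two_iff_integrable_sq (by fun_prop)]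
  refine (GaussianFourier.integrable_cexp_neg_mul_sq_norm_add (b := 1) (by simp) 2 ξ).norm.congr
    (ae_of_all _ fun x => ?_)
  have hexponent : -1 * (‖x‖ : ℂ) ^ 2 + 2 * (⟪ξ, x⟫ : ℂ) =
      ((2 * (⟪ξ, x⟫ + -(‖x‖ ^ 2 / 2)) : ℝ) : ℂ) := by
    push_cast
    ring
  simp only [hexponent, Complex.norm_exp, Complex.ofReal_re, gaussian_apply, Complex.norm_real,
    Real.norm_eq_abs, Real.abs_exp, ← Real.exp_add, ← Real.exp_nat_mul, Nat.cast_ofNat]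

theorem integrable_exp_abs_inner_mul_gaussian_mul (ξ : EuclideanSpace ℝ (Fin n)) (g : L2 n) :
    Integrable fun x => Real.exp |⟪ξ, x⟫| * ‖gaussian _ x * g x‖ := by
  have hexp (η : EuclideanSpace ℝ (Fin n)) :=
    (memLp_exp_inner_mul_gaussian η).integrable_mul (Lp.memLp g).norm
  refine ((hexp ξ).add (hexp (-ξ))).mono' ?_ (ae_of_all _ fun x => ?_)
  · exact (by fun_prop : Continuous fun x : EuclideanSpace ℝ (Fin n) =>
      Real.exp |⟪ξ, x⟫|).aestronglyMeasurable.mul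
        ((gaussian _).continuous.aestronglyMeasurable.mul (Lp.aestronglyMeasurable g)).norm
  · simp only [Real.norm_eq_abs, Pi.add_apply, Pi.mul_apply, inner_neg_left, norm_mul,
      Real.abs_exp, abs_norm, ← mul_assoc, ← add_mul]
    gcongr
    exact Real.exp_abs_le _

theorem inner_eq_zero_of_mem_hermiteSpan {g : L2 n}
    (hg : ∀ m : Fin n → ℕ, inner ℂ g ((hermite m).toLp 2 volume) = 0)
    {φ : 𝓢(EuclideanSpace ℝ (Fin n), ℂ)} (hφ : φ ∈ hermiteSpan n) :
    inner ℂ g (φ.toLp 2 volume) = 0 := by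
  have hle : hermiteSpan n ≤
      ((innerSL ℂ g).comp (SchwartzMap.toLpCLM ℂ ℂ 2 volume)).ker :=
    Submodule.span_le.mpr (Set.range_subset_iff.mpr hg)
  exact hle hφ

theorem integral_inner_pow_mul_gaussian_mul_eq_zero {g : L2 n}
    (hg : ∀ m : Fin n → ℕ, inner ℂ g ((hermite m).toLp 2 volume) = 0)
    (ξ : EuclideanSpace ℝ (Fin n)) (k : ℕ) :
    ∫ x, (⟪ξ, x⟫ : ℂ) ^ k * (gaussian _ x * g x) = 0 := by
  obtain ⟨φ, hφ, hφx⟩ := exists_mem_hermiteSpan_eq_inner_pow_mul_gaussian ξ k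
  rw [← inner_eq_zero_symm.mp (inner_eq_zero_of_mem_hermiteSpan hg hφ), L2.inner_def]
  refine integral_congr_ae ?_
  filter_upwards [φ.coeFn_toLp 2 volume] with x hx
  rw [hx, hφx, RCLike.inner_apply]
  simp only [gaussian_apply, map_mul, map_pow, Complex.conj_ofReal]
  ring

theorem eq_zero_of_inner_hermite_eq_zero {g : L2 n}
    (hg : ∀ m : Fin n → ℕ, inner ℂ g ((hermite m).toLp 2 volume) = 0) : g = 0 := by
  have hmeas : AEStronglyMeasurable fun x => gaussian _ x * g x :=
    (gaussian _).continuous.aestronglyMeasurable.mul (Lp.aestronglyMeasurable g)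
  have hintegrable : Integrable fun x => gaussian _ x * g x := by
    rw [← integrable_norm_iff hmeas]
    simpa using integrable_exp_abs_inner_mul_gaussian_mul 0 g
  have hzero : ∀ᵐ x, gaussian _ x * g x = 0 :=
    ae_eq_zero_of_fourier_eq_zero hintegrable <| fourier_eq_zero_of_moments_eq_zero hmeas
      (integrable_exp_abs_inner_mul_gaussian_mul · g)
      (integral_inner_pow_mul_gaussian_mul_eq_zero hg)
  rw [Lp.eq_zero_iff_ae_eq_zero]
  filter_upwards [hzero] with x hx
  refine (mul_eq_zero.mp hx).resolve_left ?_
  simp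

theorem orthogonal_span_hermiteFun :
    (Submodule.span ℂ (Set.range fun m : Fin n → ℕ => ((hermiteFun m).toLp 2 volume : L2 n)))ᗮ =
      ⊥ := by
  refine (Submodule.eq_bot_iff _).mpr fun g hg => eq_zero_of_inner_hermite_eq_zero fun m => ?_
  have h := (Submodule.mem_orthogonal' _ _).mp hg _ (Submodule.subset_span ⟨m, rfl⟩)
  simp only [hermiteFun, toLp_smul, inner_smul_right] at h
  refine (mul_eq_zero.mp h).resolve_left ?_
  simpa using toLp_hermite_ne_zero m

/-- The Hilbert basis of `L²(ℝⁿ)` formed by the Hermite functions. -/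
def hermiteBasis (n : ℕ) : HilbertBasis (Fin n → ℕ) ℂ (L2 n) :=
  HilbertBasis.mkOfOrthogonalEqBot orthonormal_hermiteFun orthogonal_span_hermiteFun

theorem hermiteBasis_apply (m : Fin n → ℕ) :
    hermiteBasis n m = (hermiteFun m).toLp 2 volume :=
  congrFun (HilbertBasis.coe_mkOfOrthogonalEqBot _ _) m

theorem toLp_sum_smul_hermiteFun (c : (Fin n → ℕ) → ℂ) (s : Finset (Fin n → ℕ)) :
    (∑ m ∈ s, c m • hermiteFun m).toLp 2 volume = (∑ m ∈ s, c m • hermiteBasis n m : L2 n) := by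
  rw [← SchwartzMap.toLpCLM_apply (𝕜 := ℂ), map_sum]
  simp only [map_smul, SchwartzMap.toLpCLM_apply, hermiteBasis_apply]

theorem graph_diagOp_hermiteBasis_subset_closure (j : Fin n) :
    ((diagOp (hermiteBasis n) fun m => (m j : ℝ)).graph : Set (L2 n × L2 n)) ⊆
      closure (Set.range fun φ : 𝓢(EuclideanSpace ℝ (Fin n), ℂ) =>
        (φ.toLp 2, (number j φ).toLp 2)) := by
  rintro ⟨ψ, χ⟩ hp
  refine mem_closure_of_tendsto (((hermiteBasis n).hasSum_repr ψ).prodMk_nhds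
    ((hermiteBasis n).hasSum_repr χ)) (.of_forall fun s => ?_)
  refine ⟨∑ m ∈ s, (hermiteBasis n).repr ψ m • hermiteFun m, ?_⟩
  simp only [map_sum, map_smul, number_hermiteFun, smul_smul, toLp_sum_smul_hermiteFun,
    (mem_graph_diagOp _ _ _).mp hp, mul_comm, Complex.ofReal_natCast]

theorem toLp_number_mem_graph_diagOp_hermiteBasis (j : Fin n)
    (φ : 𝓢(EuclideanSpace ℝ (Fin n), ℂ)) :
    (φ.toLp 2 volume, (number j φ).toLp 2 volume) ∈
      (diagOp (hermiteBasis n) fun m => (m j : ℝ)).graph := by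
  refine (mem_graph_diagOp _ _ _).mpr fun m => ?_
  rw [HilbertBasis.repr_apply_apply, HilbertBasis.repr_apply_apply, hermiteBasis_apply,
    ← inner_number, number_hermiteFun, toLp_smul, inner_smul_left, Complex.conj_natCast,
    Complex.ofReal_natCast]

theorem isClosureOf_number (j : Fin n) :
    IsClosureOf (diagOp (hermiteBasis n) fun m => (m j : ℝ)) (number j) :=
  (graph_diagOp_hermiteBasis_subset_closure j).antisymm <|
    closure_minimal (Set.range_subset_iff.mpr (toLp_number_mem_graph_diagOp_hermiteBasis j))
      (isSelfAdjoint_diagOp _ _).isClosed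

end Completeness

/-! ### The number operators as quantizations -/

section Weyl

variable {n : ℕ}

theorem weyl_eq_sum {q : MvPolynomial (Fin n ⊕ Fin n) ℝ} {t : Finset ((Fin n ⊕ Fin n) →₀ ℕ)}
    (ht : q.support ⊆ t) : weyl q = ∑ s ∈ t, ((q.coeff s : ℝ) : ℂ) • weylMonomial s := by
  refine Finset.sum_subset ht fun s _ hs => ?_
  rw [MvPolynomial.notMem_support_iff.mp hs, Complex.ofReal_zero, zero_smul]

theorem weyl_add (p q : MvPolynomial (Fin n ⊕ Fin n) ℝ) : weyl (p + q) = weyl p + weyl q := by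
  classical
  rw [weyl_eq_sum (MvPolynomial.support_add (p := p) (q := q)),
    weyl_eq_sum (Finset.subset_union_left (s₁ := p.support) (s₂ := q.support)),
    weyl_eq_sum (Finset.subset_union_right (s₁ := p.support) (s₂ := q.support)),
    ← Finset.sum_add_distrib]
  simp only [MvPolynomial.coeff_add, Complex.ofReal_add, add_smul]

theorem weyl_monomial (s : (Fin n ⊕ Fin n) →₀ ℕ) (c : ℝ) :
    weyl (MvPolynomial.monomial s c) = (c : ℂ) • weylMonomial s := by
  classical
  rw [weyl_eq_sum (MvPolynomial.support_monomial_subset (s := s) (a := c)), Finset.sum_singleton,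
    MvPolynomial.coeff_monomial, if_pos rfl]

theorem weylMonomial_single (i : Fin n ⊕ Fin n) (k : ℕ) :
    weylMonomial (Finsupp.single i k) = Sum.elim position momentum i ^ k := by
  have hlist : (Finsupp.toMultiset (Finsupp.single i k)).toList = List.replicate k i := by
    rw [Finsupp.toMultiset_single, Multiset.nsmul_singleton]
    refine List.eq_replicate_iff.mpr ⟨by simp, fun x hx => ?_⟩
    exact Multiset.eq_of_mem_replicate (Multiset.mem_toList.mp hx)
  have hperm : ∀ l ∈ (List.replicate k i).permutations,
      (l.map (Sum.elim position momentum)).prod = Sum.elim position momentum i ^ k := by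
    intro l hl
    rw [List.perm_replicate.mp (List.mem_permutations.mp hl), List.map_replicate,
      List.prod_replicate]
  simp only [weylMonomial, hlist]
  rw [List.map_congr_left hperm, List.map_const', List.sum_replicate, List.length_permutations,
    List.length_replicate, ← Nat.cast_smul_eq_nsmul ℂ, smul_smul,
    inv_mul_cancel₀ (Nat.cast_ne_zero.mpr k.factorial_ne_zero), one_smul]

/-- The classical symbol `(x_j² + p_j² - 1) / 2` of the number operator. -/
def numberSymbol (j : Fin n) : MvPolynomial (Fin n ⊕ Fin n) ℝ :=
  MvPolynomial.monomial (Finsupp.single (Sum.inl j) 2) 2⁻¹ +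
    MvPolynomial.monomial (Finsupp.single (Sum.inr j) 2) 2⁻¹ +
      MvPolynomial.monomial (Finsupp.single (Sum.inl j) 0) (-2⁻¹)

theorem weyl_numberSymbol (j : Fin n) : weyl (numberSymbol j) = number j := by
  rw [← inv_smul_smul₀ (two_ne_zero (α := ℂ)) (number j), two_smul_number, numberSymbol]
  simp only [weyl_add, weyl_monomial, weylMonomial_single, Sum.elim_inl, Sum.elim_inr, pow_zero,
    Complex.ofReal_neg, Complex.ofReal_inv, Complex.ofReal_ofNat]
  module

theorem eval_numberSymbol (j : Fin n) (z : Phase n) :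
    MvPolynomial.eval z (numberSymbol j) =
      2⁻¹ * z (Sum.inl j) ^ 2 + 2⁻¹ * z (Sum.inr j) ^ 2 - 2⁻¹ := by
  simp [numberSymbol, MvPolynomial.eval_monomial, sub_eq_add_neg]

theorem isQuantization_number (j : Fin n) :
    IsQuantization (fun z => MvPolynomial.eval z (numberSymbol j))
      (diagOp (hermiteBasis n) fun m => (m j : ℝ)) :=
  IsQuantization.polynomial _ _ (isSelfAdjoint_diagOp _ _)
    (weyl_numberSymbol j ▸ isClosureOf_number j)

end Weyl

/-! ### The classical system -/

section Interpolation

theorem eventually_forall_eq_imp_eq {E ι : Type*} [PseudoMetricSpace E] {e : ι → E} {δ : ℝ}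
    (hδ : 0 < δ) (he : Pairwise fun i j => δ ≤ dist (e i) (e j)) (l : ι → ℝ) (x : E) :
    ∃ c, ∀ᶠ y in nhds x, ∀ i, e i = y → c = l i := by
  -- The ball of radius `δ / 2` contains at most one of the points.
  have hball := Metric.ball_mem_nhds x (half_pos hδ)
  by_cases hex : ∃ i, e i ∈ Metric.ball x (δ / 2)
  · obtain ⟨i, hi⟩ := hex
    refine ⟨l i, Filter.mem_of_superset hball ?_⟩
    rintro _ hy i' rfl
    by_contra hne
    have hclose : dist (e i) (e i') < δ / 2 + δ / 2 :=
      (dist_triangle_right _ _ x).trans_lt (add_lt_add hi hy)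
    exact (add_halves δ ▸ hclose).not_ge (he fun h => hne (congrArg l h))
  · refine ⟨0, Filter.mem_of_superset hball ?_⟩
    rintro _ hy i rfl
    exact absurd ⟨i, hy⟩ hex

open scoped Manifold in
theorem exists_contDiff_interpolation {E ι : Type*} [NormedAddCommGroup E] [NormedSpace ℝ E]
    [FiniteDimensional ℝ E] {e : ι → E} {δ : ℝ} (hδ : 0 < δ)
    (he : Pairwise fun i j => δ ≤ dist (e i) (e j)) (l : ι → ℝ) :
    ∃ f : E → ℝ, ContDiff ℝ ∞ f ∧ ∀ i, f (e i) = l i := by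
  have hconvex (y : E) : Convex ℝ {c : ℝ | ∀ i, e i = y → c = l i} := by
    simp only [Set.ofPred_forall]
    exact convex_iInter fun i => convex_iInter fun _ => convex_singleton _
  obtain ⟨f, hf⟩ := exists_contMDiffMap_forall_mem_convex_of_local_const (n := ⊤)
    𝓘(ℝ, E) hconvex (eventually_forall_eq_imp_eq hδ he l)
  exact ⟨f, f.contMDiff.contDiff, fun i => hf _ i rfl⟩

theorem one_le_dist_natCast {ι : Type*} [Fintype ι] :
    Pairwise fun m m' : ι → ℕ => 1 ≤ dist (fun j => (m j : ℝ)) (fun j => (m' j : ℝ)) := by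
  intro m m' hne
  obtain ⟨j, hj⟩ := Function.ne_iff.mp hne
  calc (1 : ℝ) ≤ dist (m j) (m' j) := Nat.pairwise_one_le_dist hj
    _ = dist (m j : ℝ) (m' j : ℝ) := (Nat.dist_cast_real _ _).symm
    _ ≤ _ := dist_le_pi_dist (fun j => (m j : ℝ)) (fun j => (m' j : ℝ)) j

end Interpolation

section Classical

variable {n : ℕ}

theorem fderiv_comp_apply_eq_sum {ι V : Type*} [Fintype ι] [DecidableEq ι] [NormedAddCommGroup V]
    [NormedSpace ℝ V] {f : (ι → ℝ) → ℝ} {t : ι → V → ℝ} {z : V}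
    (hf : DifferentiableAt ℝ f fun k => t k z) (ht : ∀ k, DifferentiableAt ℝ (t k) z) (v : V) :
    fderiv ℝ (fun z => f fun k => t k z) z v =
      ∑ k, fderiv ℝ f (fun k => t k z) (Pi.single k 1) * fderiv ℝ (t k) z v := by
  have hcomp : fderiv ℝ (fun z => f fun k => t k z) z v =
      fderiv ℝ f (fun k => t k z) fun k => fderiv ℝ (t k) z v :=
    DFunLike.congr_fun
      (hf.hasFDerivAt.comp z (hasFDerivAt_pi.mpr fun k => (ht k).hasFDerivAt)).fderiv v
  rw [hcomp, pi_eq_sum_univ' fun k => fderiv ℝ (t k) z v, map_sum]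
  simp only [map_smul, smul_eq_mul, mul_comm]

theorem poisson_comp {ι : Type*} [Fintype ι] [DecidableEq ι] {f : (ι → ℝ) → ℝ}
    {t : ι → Phase n → ℝ} {z : Phase n} (hf : DifferentiableAt ℝ f fun k => t k z)
    (ht : ∀ k, DifferentiableAt ℝ (t k) z) (b : Phase n → ℝ) :
    poisson (fun z => f fun k => t k z) b z =
      ∑ k, fderiv ℝ f (fun k => t k z) (Pi.single k 1) * poisson (t k) b z := by
  simp only [poisson, fderiv_comp_apply_eq_sum hf ht, Finset.mul_sum, Finset.sum_mul,
    ← Finset.sum_sub_distrib]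
  rw [Finset.sum_comm]
  refine Finset.sum_congr rfl fun k _ => Finset.sum_congr rfl fun j _ => ?_
  ring

theorem hasFDerivAt_numberSymbol (j : Fin n) (z : Phase n) :
    HasFDerivAt (fun z => MvPolynomial.eval z (numberSymbol j))
      (z (Sum.inl j) •
          ContinuousLinearMap.proj (R := ℝ) (φ := fun _ : Fin n ⊕ Fin n => ℝ) (Sum.inl j) +
        z (Sum.inr j) •
          ContinuousLinearMap.proj (R := ℝ) (φ := fun _ : Fin n ⊕ Fin n => ℝ) (Sum.inr j)) z := by
  have hsq (i : Fin n ⊕ Fin n) :=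
    ((hasFDerivAt_apply (𝕜 := ℝ) i z).pow 2).const_mul (2⁻¹ : ℝ)
  simp only [eval_numberSymbol]
  refine (((hsq (Sum.inl j)).add (hsq (Sum.inr j))).sub_const (2⁻¹ : ℝ)).congr_fderiv ?_
  ext v
  simp [← mul_assoc]

theorem fderiv_numberSymbol_apply (j : Fin n) (z v : Phase n) :
    fderiv ℝ (fun z => MvPolynomial.eval z (numberSymbol j)) z v =
      z (Sum.inl j) * v (Sum.inl j) + z (Sum.inr j) * v (Sum.inr j) := by
  rw [(hasFDerivAt_numberSymbol j z).fderiv]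
  rfl

theorem contDiff_numberSymbol (j : Fin n) :
    ContDiff ℝ ∞ fun z : Phase n => MvPolynomial.eval z (numberSymbol j) := by
  simp only [eval_numberSymbol]
  fun_prop

theorem poisson_numberSymbol (i j : Fin n) (z : Phase n) :
    poisson (fun z => MvPolynomial.eval z (numberSymbol i))
      (fun z => MvPolynomial.eval z (numberSymbol j)) z = 0 := by
  refine Finset.sum_eq_zero fun k _ => ?_
  simp only [fderiv_numberSymbol_apply]
  rcases eq_or_ne i j with rfl | hij
  · ring
  · rcases eq_or_ne i k with rfl | hik
    · simp [hij.symm]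
    · simp [hik]

theorem dense_linearIndependent_fderiv_numberSymbol :
    Dense {z : Phase n | LinearIndependent ℝ
      fun i => fderiv ℝ (fun z => MvPolynomial.eval z (numberSymbol i)) z} := by
  have hdense : Dense (Set.pi Set.univ fun _ : Fin n ⊕ Fin n => ({0}ᶜ : Set ℝ)) :=
    dense_pi _ fun _ _ => dense_compl_singleton 0
  refine hdense.mono fun z hz => Fintype.linearIndependent_iff.mpr fun g hg i => ?_
  have hzi : z (Sum.inl i) ≠ 0 := hz (Sum.inl i) (Set.mem_univ _)
  have h := DFunLike.congr_fun hg (Pi.single (Sum.inl i) 1)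
  simp only [sum_apply, smul_apply,
    fderiv_numberSymbol_apply] at h
  simpa [Pi.single_apply, hzi] using h

theorem isLiouvilleIntegrable_comp_numberSymbol {f : (Fin n → ℝ) → ℝ} (hf : ContDiff ℝ ∞ f) :
    IsLiouvilleIntegrable (fun z => f fun j => MvPolynomial.eval z (numberSymbol j))
      (fun i z => MvPolynomial.eval z (numberSymbol (n := n) i)) where
  smooth_hamiltonian := hf.comp (contDiff_pi.mpr contDiff_numberSymbol)
  smooth := contDiff_numberSymbol
  first_integral i z := by
    rw [poisson_comp (hf.differentiable (by simp) _)
      fun j => (hasFDerivAt_numberSymbol j z).differentiableAt]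
    simp only [poisson_numberSymbol, mul_zero, Finset.sum_const_zero]
  involution := poisson_numberSymbol
  independent := dense_linearIndependent_fderiv_numberSymbol

end Classical

/-! ### Eigenvectors of spectral integrals -/

section SpectralIntegral

variable {ℋ : Type*} [NormedAddCommGroup ℋ] [InnerProductSpace ℂ ℋ]

theorem inner_eq_zero_of_forall_phase_inner_eq {φ χ φ' χ' : ℋ} {q : ℂ}
    (h : ∀ z : ℂ, ‖z‖ = 1 → inner ℂ (φ + z • χ) (φ' + z • χ') = q) : inner ℂ φ χ' = 0 := by
  have h_one := h 1 (by simp)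
  have h_neg_one := h (-1) (by simp)
  have h_I := h Complex.I (by simp)
  have h_neg_I := h (-Complex.I) (by simp)
  simp only [inner_add_left, inner_add_right, inner_smul_left, inner_smul_right, map_neg, map_one,
    Complex.conj_I] at h_one h_neg_one h_I h_neg_I
  linear_combination (1 / 4 : ℂ) * h_one - (1 / 4 : ℂ) * h_neg_one - (Complex.I / 4) * h_I +
    (Complex.I / 4) * h_neg_I +
      ((inner ℂ φ χ' - inner ℂ χ φ') / 2) * Complex.I_mul_I

variable [CompleteSpace ℋ] {α : Type*} [MeasurableSpace α]

instance PVM.isFiniteMeasure_measure (E : PVM α ℋ) (ψ : ℋ) : IsFiniteMeasure (E.measure ψ) :=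
  ⟨by rw [E.measure_apply ψ .univ]; exact ENNReal.ofReal_lt_top⟩

theorem PVM.measure_ne_zero (E : PVM α ℋ) {ψ : ℋ} (hψ : ψ ≠ 0) : E.measure ψ ≠ 0 := by
  intro h
  have huniv := E.measure_apply ψ .univ
  rw [h, E.proj_univ, one_apply_eq_self, Measure.coe_zero, Pi.zero_apply, eq_comm,
    ENNReal.ofReal_eq_zero] at huniv
  exact (pow_pos (norm_pos_iff.mpr hψ) 2).not_ge huniv

theorem PVM.proj_proj (E : PVM α ℋ) {s t : Set α} (hs : MeasurableSet s) (ht : MeasurableSet t)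
    (ψ : ℋ) : E.proj s (E.proj t ψ) = E.proj (s ∩ t) ψ :=
  (DFunLike.congr_fun (E.proj_inter s t hs ht) ψ).symm

theorem PVM.measure_proj (E : PVM α ℋ) (ψ : ℋ) {s : Set α} (hs : MeasurableSet s) :
    E.measure (E.proj s ψ) = (E.measure ψ).restrict s := by
  ext t ht
  rw [Measure.restrict_apply ht, E.measure_apply _ ht, E.measure_apply _ (ht.inter hs),
    E.proj_proj ht hs]

open Classical in
/-- The vector measure `s ↦ E(s) ψ`; vector measures vanish on non-measurable sets by
convention. -/
def PVM.vectorMeasure (E : PVM α ℋ) (ψ : ℋ) : VectorMeasure α ℋ where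
  measureOf' s := if MeasurableSet s then E.proj s ψ else 0
  empty' := by simp [E.proj_empty]
  not_measurable' _ hs := if_neg hs
  m_iUnion' s hs hd := by
    simpa only [hs, MeasurableSet.iUnion hs, if_true] using E.hasSum_iUnion s hs hd ψ

theorem PVM.vectorMeasure_apply (E : PVM α ℋ) (ψ : ℋ) {s : Set α} (hs : MeasurableSet s) :
    E.vectorMeasure ψ s = E.proj s ψ :=
  if_pos hs

theorem PVM.proj_add_proj_compl (E : PVM α ℋ) (ψ : ℋ) {s : Set α} (hs : MeasurableSet s) :
    E.proj s ψ + E.proj sᶜ ψ = ψ := by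
  have h := VectorMeasure.of_add_of_sdiff (v := E.vectorMeasure ψ) hs .univ (Set.subset_univ s)
  rwa [← Set.compl_eq_univ_sdiff, E.vectorMeasure_apply ψ hs, E.vectorMeasure_apply ψ hs.compl,
    E.vectorMeasure_apply ψ .univ, E.proj_univ] at h

theorem PVM.inner_proj_proj_of_disjoint (E : PVM α ℋ) (ψ φ : ℋ) {s t : Set α}
    (hs : MeasurableSet s) (ht : MeasurableSet t) (hst : Disjoint s t) :
    inner ℂ (E.proj s ψ) (E.proj t φ) = 0 := by
  have hsymm := (ContinuousLinearMap.isSelfAdjoint_iff_isSymmetric.mp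
    (E.isStarProjection s hs).isSelfAdjoint) ψ (E.proj t φ)
  rw [ContinuousLinearMap.coe_coe, E.proj_proj hs ht, hst.inter_eq, E.proj_empty,
    zero_apply, inner_zero_right] at hsymm
  exact hsymm

theorem PVM.norm_proj_add_smul_proj_compl (E : PVM α ℋ) (ψ : ℋ) {s : Set α}
    (hs : MeasurableSet s) {z : ℂ} (hz : ‖z‖ = 1) : ‖E.proj s ψ + z • E.proj sᶜ ψ‖ = ‖ψ‖ := by
  have hpythagoras (w : ℂ) (hw : ‖w‖ = 1) : ‖E.proj s ψ + w • E.proj sᶜ ψ‖ ^ 2 =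
      ‖E.proj s ψ‖ ^ 2 + ‖E.proj sᶜ ψ‖ ^ 2 := by
    have horth : inner ℂ (E.proj s ψ) (w • E.proj sᶜ ψ) = 0 := by
      rw [inner_smul_right, E.inner_proj_proj_of_disjoint ψ ψ hs hs.compl disjoint_compl_right,
        mul_zero]
    rw [sq, sq, sq, norm_add_sq_eq_norm_sq_add_norm_sq_of_inner_eq_zero _ _ horth, norm_smul, hw,
      one_mul]
  have h := (hpythagoras z hz).trans (hpythagoras 1 norm_one).symm
  rw [one_smul, E.proj_add_proj_compl ψ hs] at h
  exact (sq_eq_sq₀ (norm_nonneg _) (norm_nonneg _)).mp h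

theorem PVM.measure_proj_add_smul_proj_compl (E : PVM α ℋ) (ψ : ℋ) {s : Set α}
    (hs : MeasurableSet s) {z : ℂ} (hz : ‖z‖ = 1) :
    E.measure (E.proj s ψ + z • E.proj sᶜ ψ) = E.measure ψ := by
  ext t ht
  have hproj : E.proj t (E.proj s ψ + z • E.proj sᶜ ψ) =
      E.proj s (E.proj t ψ) + z • E.proj sᶜ (E.proj t ψ) := by
    rw [map_add, map_smul, E.proj_proj ht hs, E.proj_proj ht hs.compl, E.proj_proj hs ht,
      E.proj_proj hs.compl ht, Set.inter_comm t, Set.inter_comm t]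
  rw [E.measure_apply _ ht, E.measure_apply _ ht, hproj, E.norm_proj_add_smul_proj_compl _ hs hz]

variable {E : PVM α ℋ} {f : α → ℝ} {B : ℋ →ₗ.[ℂ] ℋ}

theorem PVM.IsIntegral.proj_mem_domain (hB : E.IsIntegral f B) {ψ : ℋ} (hψ : ψ ∈ B.domain)
    {s : Set α} (hs : MeasurableSet s) : E.proj s ψ ∈ B.domain := by
  rw [hB.1, E.measure_proj ψ hs]
  exact ((hB.1 ψ).mp hψ).restrict

theorem PVM.IsIntegral.integrable (hB : E.IsIntegral f B) (hf : Measurable f) {ψ : ℋ}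
    (hψ : ψ ∈ B.domain) : Integrable f (E.measure ψ) :=
  ((memLp_two_iff_integrable_sq hf.aestronglyMeasurable).mpr ((hB.1 ψ).mp hψ)).integrable
    one_le_two

theorem PVM.IsIntegral.setIntegral_eq_inner (hB : E.IsIntegral f B) (ψ : B.domain) {s : Set α}
    (hs : MeasurableSet s) :
    ((∫ x in s, f x ∂E.measure ψ : ℝ) : ℂ) = inner ℂ (E.proj s ψ) (B ψ) := by
  let φ : B.domain := ⟨E.proj s ψ, hB.proj_mem_domain ψ.2 hs⟩
  let χ : B.domain := ⟨E.proj sᶜ ψ, hB.proj_mem_domain ψ.2 hs.compl⟩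
  -- Changing the phase of `χ` preserves the spectral measure of `φ + χ`, hence the quadratic form.
  have hphase (z : ℂ) (hz : ‖z‖ = 1) :
      inner ℂ ((φ : ℋ) + z • (χ : ℋ)) (B φ + z • B χ) = ((∫ x, f x ∂E.measure ψ : ℝ) : ℂ) := by
    rw [← B.map_smul, ← B.map_add, ← E.measure_proj_add_smul_proj_compl ψ hs hz]
    exact hB.2 (φ + z • χ)
  have hψ : ψ = φ + χ := Subtype.ext (E.proj_add_proj_compl ψ hs).symm
  calc ((∫ x in s, f x ∂E.measure ψ : ℝ) : ℂ) = inner ℂ (φ : ℋ) (B φ) := by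
        rw [← E.measure_proj _ hs]
        exact (hB.2 φ).symm
    _ = inner ℂ (φ : ℋ) (B φ + B χ) := by
        rw [inner_add_right, inner_eq_zero_of_forall_phase_inner_eq hphase, add_zero]
    _ = inner ℂ (E.proj s ψ) (B ψ) := by rw [← B.map_add, ← hψ]

theorem PVM.IsIntegral.ae_eq_of_eigenvector (hB : E.IsIntegral f B) (hf : Measurable f) {ψ : ℋ}
    {c : ℝ} (hψ : (ψ, (c : ℂ) • ψ) ∈ B.graph) : ∀ᵐ x ∂E.measure ψ, f x = c := by
  obtain ⟨⟨ψ, hdom⟩, rfl, hBψ⟩ := (LinearPMap.mem_graph_iff _).mp hψ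
  refine (hB.integrable hf hdom).ae_eq_of_forall_setIntegral_eq _ (fun _ => c)
    (integrable_const c) fun s hs _ => ?_
  have hset := congrArg Complex.re (hB.setIntegral_eq_inner ⟨ψ, hdom⟩ hs)
  have hre : (inner ℂ (E.proj s ψ) ψ).re = ‖E.proj s ψ‖ ^ 2 :=
    (inner_re_symm (𝕜 := ℂ) _ _).trans (E.inner_proj hs ψ)
  rw [hBψ, inner_smul_right, Complex.ofReal_re, Complex.re_ofReal_mul, hre] at hset
  rw [hset, setIntegral_const, measureReal_def, E.measure_apply ψ hs,
    ENNReal.toReal_ofReal (by positivity), smul_eq_mul, mul_comm]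

/-! ### Functional independence -/

theorem IsFunctionOf.exists_forall_eigenvalue_eq {ι : Type*} [Countable ι] {T : ι → ℋ →ₗ.[ℂ] ℋ}
    (h : IsFunctionOf B T) :
    ∃ f : (ι → ℝ) → ℝ, ∀ ψ : ℋ, ψ ≠ 0 → ∀ (c : ι → ℝ) (d : ℝ),
      (∀ j, (ψ, (c j : ℂ) • ψ) ∈ (T j).graph) → (ψ, (d : ℂ) • ψ) ∈ B.graph → f c = d := by
  obtain ⟨E, hE, f, hf, hB⟩ := h
  refine ⟨f, fun ψ hψ c d hc hd => ?_⟩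
  have hpoint : ∀ᵐ x ∂E.measure ψ, x = c := by
    simp only [funext_iff]
    exact ae_all_iff.mpr fun j => (hE j).ae_eq_of_eigenvector (measurable_pi_apply j) (hc j)
  have : (MeasureTheory.ae (E.measure ψ)).NeBot := ae_neBot.mpr (E.measure_ne_zero hψ)
  obtain ⟨x, rfl, hx⟩ := (hpoint.and (hB.ae_eq_of_eigenvector hf hd)).exists
  exact hx

theorem functionallyIndependent_diagOp {ι : Type*} [Countable ι]
    (b : HilbertBasis (ι → ℕ) ℂ ℋ) :
    FunctionallyIndependent fun j : ι => diagOp b fun m => (m j : ℝ) := by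
  classical
  intro i hi
  obtain ⟨f, hf⟩ := hi.exists_forall_eigenvalue_eq
  have hf_basis (m : ι → ℕ) : f (fun j => (m j : ℝ)) = m i :=
    hf (b m) (b.orthonormal.ne_zero m) _ _
      (fun j => basis_mem_graph_diagOp b (fun m => (m j : ℝ)) m)
      (basis_mem_graph_diagOp b (fun m => (m i : ℝ)) m)
  -- The multi-indices `0` and `Pi.single i 1` agree away from `i`.
  have hagree : (fun j : {j // j ≠ i} => ((Pi.single i 1 : ι → ℕ) j : ℝ)) =
      fun j : {j // j ≠ i} => ((0 : ι → ℕ) j : ℝ) := by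
    ext j
    rw [Pi.single_eq_of_ne j.2, Pi.zero_apply]
  have hsingle := hf_basis (Pi.single i 1)
  rw [hagree, hf_basis 0] at hsingle
  simp at hsingle

theorem areFirstIntegrals_diagOp {ι : Type*} [Finite ι] (b : HilbertBasis (ι → ℕ) ℂ ℋ)
    (l : (ι → ℕ) → ℝ) :
    AreFirstIntegrals (diagOp b l) fun j : ι => diagOp b fun m => (m j : ℝ) where
  selfAdjoint _ := isSelfAdjoint_diagOp b _
  commute _ _ := stronglyCommute_diagOp b _ _
  commute_hamiltonian _ := stronglyCommute_diagOp b _ _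
  independent := functionallyIndependent_diagOp b

end SpectralIntegral

/-! ### Integrability -/

section Integrability

theorem isQuantization_comp_numberSymbol {n : ℕ} {f : (Fin n → ℝ) → ℝ} (hf : ContDiff ℝ ∞ f) :
    IsQuantization (fun z => f fun j => MvPolynomial.eval z (numberSymbol j))
      (diagOp (hermiteBasis n) fun m => f fun j => (m j : ℝ)) := by
  let E : PVM (Fin n → ℝ) (L2 n) := diagPVM (hermiteBasis n) fun m j => (m j : ℝ)
  have hresolution :
      IsJointSpectralResolution E fun j => diagOp (hermiteBasis n) fun m => (m j : ℝ) :=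
    fun j => isIntegral_diagPVM (hermiteBasis n) (fun m j => (m j : ℝ)) fun x => x j
  have hintegral : E.IsIntegral f (diagOp (hermiteBasis n) fun m => f fun j => (m j : ℝ)) :=
    isIntegral_diagPVM (hermiteBasis n) (fun m j => (m j : ℝ)) f
  exact .calculus (fun j z => MvPolynomial.eval z (numberSymbol j)) _ isQuantization_number E
    hresolution f hf _ hintegral

theorem isIntegrableWith_diagOp {ℋ : Type*} [NormedAddCommGroup ℋ] [InnerProductSpace ℂ ℋ]
    [CompleteSpace ℋ] {n : ℕ} (b : HilbertBasis (Fin n → ℕ) ℂ ℋ) (l : (Fin n → ℕ) → ℝ) :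
    IsIntegrableWith n (diagOp b l) fun j : Fin n => diagOp b fun m => (m j : ℝ) := by
  obtain ⟨f, hf, hfl⟩ := exists_contDiff_interpolation one_pos one_le_dist_natCast l
  obtain rfl : (fun m => f fun j => (m j : ℝ)) = l := funext hfl
  exact ⟨areFirstIntegrals_diagOp b _, b.repr.trans (hermiteBasis n).repr.symm,
    diagOp (hermiteBasis n) _, fun j => diagOp (hermiteBasis n) fun m => (m j : ℝ), _, _,
    isSelfAdjoint_diagOp _ _, intertwines_diagOp b _ _, fun j => intertwines_diagOp b _ _,
    areFirstIntegrals_diagOp _ _, isQuantization_comp_numberSymbol hf, isQuantization_number,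
    isLiouvilleIntegrable_comp_numberSymbol hf⟩

end Integrability

end QuantumIntegrability

end

open QuantumIntegrability in
theorem mainTheorem4 {ℋ : Type*} [NormedAddCommGroup ℋ] [InnerProductSpace ℂ ℋ] [CompleteSpace ℋ]
    [TopologicalSpace.SeparableSpace ℋ] (hℋ : ¬ FiniteDimensional ℂ ℋ)
    (n : ℕ) (hn : 1 ≤ n) (H : ℋ →ₗ.[ℂ] ℋ) (hH : IsSelfAdjoint H)
    (hσ : (QuantumIntegrability.spectrum H).Countable) :
    QuantumIntegrability.HasPurePointSpectrum H ∧
      ∃ T : Fin n → ℋ →ₗ.[ℂ] ℋ, QuantumIntegrability.IsIntegrableWith n H T := by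
  obtain ⟨ι, b, l, rfl⟩ := exists_eq_diagOp_of_countable_spectrum hH hσ
  have : Countable ι := countable_of_orthonormal b.orthonormal
  have : Infinite ι := infinite_of_hilbertBasis b hℋ
  have : NeZero n := ⟨by omega⟩
  obtain ⟨e⟩ := nonempty_equiv_of_countable (α := Fin n → ℕ) (β := ι)
  obtain ⟨c, hc⟩ := exists_hilbertBasis_reindex b e
  have hdiag : diagOp b l = diagOp c (l ∘ e) :=
    eq_diagOp_of_eigenbasis c hH fun m => by
      rw [hc]
      exact basis_mem_graph_diagOp b l (e m)
  rw [hdiag]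
  exact ⟨hasPurePointSpectrum_diagOp c _, _, isIntegrableWith_diagOp c _⟩
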